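/- Let $G$ be a finite simple connected $4$-regular graph on $n$ vertices. An orientation $\sigma$ of $G$ gives each edge exactly one direction; its skew-adjacency matrix $S(G^\sigma)$ has $(x,y)$-entry $1$ if $\langle x,y\rangle$ is an arc, $-1$ if $\langle y,x\rangle$ is an arc, and $0$ otherwise. The skew energy $\mathcal E_S(G^\sigma)$ is the sum of the absolute values of all eigenvalues of $S(G^\sigma)$ (with multiplicity), and $\sigma$ is called optimum if $\mathcal E_S(G^\sigma)=n\sqrt{\Delta}$, where $\Delta$ is the maximum degree (here $n\sqrt\Delta=2n$). Then: (a) an orientation $\sigma$ of $G$ is optimum if and only if $S(G^\sigma)^{T}S(G^\sigma)=4I_n$; (b) $G$ has an optimum orientation if and only if $G$ is isomorphic to a graph of the class $\mathcal F$, which consists of the following graphs. * $G_1$, with vertices $u_1,\dots,u_4,v_1,\dots,v_4$: a complete graph on $u_1,\dots,u_4$, a complete graph on $v_1,\dots,v_4$, and the edges $u_iv_i$ ($1\le i\le 4$). * $G_2$, with vertices $u_1,\dots,u_6$ and all edges except $u_1u_6$, $u_2u_4$, $u_3u_5$ (the octahedron). * $G_3$, with the $14$ vertices $u,u_1,u_2,v_1,v_2,v,u_3,u_4,v_3,v_4,w,u_5,u_6,v_5$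 and the $28$ edges $uu_1,uu_2,uv_1,uv_2$; $u_1v,u_1u_3,u_1u_4$; $u_2v,u_2v_3,u_2v_4$; $v_1u_3,v_1v_3,v_1w$; $v_2u_4,v_2v_4,v_2w$; $vu_5,vu_6$; $u_3u_5,u_3v_5$; $u_4u_6,u_4v_5$; $v_3u_6,v_3v_5$; $v_4u_5,v_4v_5$; $wu_5,wu_6$. * $Q_4$, the hypercube of dimension $4$. * $\mathcal G_i$ for all integers $i\ge 1$. For sets $X,Y$ write $X*Y$ for the set of all edges $xy$ with $x\in X$, $y\in Y$, and put $U_k=\{u_{2k-1},u_{2k}\}$, $V_k=\{v_{2k-1},v_{2k}\}$. The graph $\mathcal G_1$ has vertex set $\{u,v\}\cup U_1\cup V_1\cup U_2\cup V_2$ and edge set $\{u,v\}*(U_1\cup V_1)\,\cup\, U_1*U_2\,\cup\, V_1*V_2\,\cup\, U_2*V_2$. For $i\ge2$, $\mathcal G_i$ is obtained from $\mathcal G_{i-1}$ by adding the four new vertices $U_{i+1}\cup V_{i+1}$, deleting the edges $U_i*V_i$, and adding the edges $U_i*U_{i+1}\,\cup\, V_i*V_{i+1}\,\cup\, U_{i+1}*V_{i+1}$.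 * $\mathcal H_j$ for all integers $j\ge 1$. The graph $\mathcal H_1$ has vertex set $\{u,v\}\cup U_1\cup V_1\cup U_2$ and edge set $\{u,v\}*(U_1\cup V_1)\,\cup\, (U_1\cup V_1)*U_2$. For $j\ge2$, $\mathcal H_j$ is obtained from $\mathcal H_{j-1}$ by adding the four new vertices $V_j\cup U_{j+1}$, deleting the edges $V_{j-1}*U_j$, and adding the edges $V_{j-1}*V_j\,\cup\, U_j*U_{j+1}\,\cup\, V_j*U_{j+1}$. -/

import Mathlib

open scoped Matrix

namespace OptimumSkew

/-- An orientation of a simple graph: every edge is given exactly one of its two directions;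
`arc x y` says that `⟨x, y⟩` is an arc of the resulting oriented graph. -/
structure GraphOrientation {V : Type*} (G : SimpleGraph V) where
  arc : V → V → Prop
  adj_iff : ∀ x y, G.Adj x y ↔ arc x y ∨ arc y x
  asymm : ∀ x y, arc x y → ¬ arc y x

namespace GraphOrientation

variable {V : Type*} {G : SimpleGraph V}

open Classical in
/-- The skew-adjacency matrix: the entry at `(x, y)` is `1` if `⟨x, y⟩` is an arc, `-1` if
`⟨y, x⟩` is an arc, and `0` otherwise. -/
noncomputable def skewAdjMatrix (R : Type*) [Ring R] (σ : GraphOrientation G) : Matrix V V R :=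
  Matrix.of fun x y => if σ.arc x y then 1 else if σ.arc y x then -1 else 0

variable [Fintype V] [DecidableEq V]

/-- The skew energy: the sum of the absolute values of all complex eigenvalues of the
skew-adjacency matrix, counted with algebraic multiplicity. -/
noncomputable def skewEnergy (σ : GraphOrientation G) : ℝ :=
  ((σ.skewAdjMatrix ℂ).charpoly.roots.map fun z => ‖z‖).sum

/-- The skew energy equals `n √Δ`, with `n` the number of vertices and `Δ` the maximum degree. -/
def IsOptimum [DecidableRel G.Adj] (σ : GraphOrientation G) : Prop :=
  σ.skewEnergy = (Fintype.card V : ℝ) * Real.sqrt (G.maxDegree : ℝ)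

end GraphOrientation

/-- `K₄` on `u₁,u₂,u₃,u₄` (numbered `0,1,2,3`), `K₄` on `v₁,v₂,v₃,v₄` (numbered `4,5,6,7`), and
the four edges `uᵢvᵢ`. -/
def graphG1 : SimpleGraph (Fin 8) :=
  SimpleGraph.fromEdgeSet
    {s(0, 1), s(0, 2), s(0, 3), s(1, 2), s(1, 3), s(2, 3),
     s(4, 5), s(4, 6), s(4, 7), s(5, 6), s(5, 7), s(6, 7),
     s(0, 4), s(1, 5), s(2, 6), s(3, 7)}

/-- The octahedron; `u₁,…,u₆` are numbered `0,…,5`. -/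
def graphG2 : SimpleGraph (Fin 6) :=
  SimpleGraph.fromEdgeSet
    {s(0, 1), s(0, 2), s(0, 3), s(0, 4), s(1, 2), s(1, 4),
     s(2, 3), s(3, 4), s(1, 5), s(2, 5), s(3, 5), s(4, 5)}

/-- The vertices `u,u₁,u₂,v₁,v₂,v,u₃,u₄,v₃,v₄,w,u₅,u₆,v₅` are numbered `0,…,13` in this order. -/
def graphG3 : SimpleGraph (Fin 14) :=
  SimpleGraph.fromEdgeSet
    {s(0, 1), s(0, 2), s(0, 3), s(0, 4),
     s(1, 5), s(1, 6), s(1, 7), s(2, 5), s(2, 8), s(2, 9),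
     s(3, 6), s(3, 8), s(3, 10), s(4, 7), s(4, 9), s(4, 10),
     s(5, 11), s(5, 12), s(6, 11), s(6, 13), s(7, 12), s(7, 13),
     s(8, 12), s(8, 13), s(9, 11), s(9, 13), s(10, 11), s(10, 12)}

/-- The hypercube `Q₄`: binary words of length `4`, adjacent when they differ in exactly one
position. -/
def graphQ4 : SimpleGraph (Fin 4 → Bool) where
  Adj x y := hammingDist x y = 1
  symm := ⟨fun x y h => by rwa [hammingDist_comm]⟩
  loopless := ⟨fun x h => by simp at h⟩

/-- The names `u`, `v`, `u_k`, `v_k` from which the vertices of the two families are drawn. -/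
inductive Vtx where
  | u : Vtx
  | v : Vtx
  | us : ℕ → Vtx
  | vs : ℕ → Vtx
  deriving DecidableEq

open Vtx

/-- Vertex set of `𝓖_i` for `i ≥ 1` (the value at `0` is a dummy). -/
def famGVerts : ℕ → Set Vtx
  | 0 => ∅
  | 1 => {u, v} ∪ {us 1, us 2, vs 1, vs 2} ∪ {us 3, us 4, vs 3, vs 4}
  | k + 2 =>
    let i := k + 2
    famGVerts (k + 1) ∪ {us (2*i+1), us (2*i+2), vs (2*i+1), vs (2*i+2)}

/-- Edge set of `𝓖_i` for `i ≥ 1` (the value at `0` is a dummy). -/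
def famGEdges : ℕ → Set (Sym2 Vtx)
  | 0 => ∅
  | 1 =>
    {s(u, us 1), s(u, us 2), s(u, vs 1), s(u, vs 2),
      s(v, us 1), s(v, us 2), s(v, vs 1), s(v, vs 2)}
    ∪ {s(us 1, us 3), s(us 1, us 4), s(us 2, us 3), s(us 2, us 4),
      s(vs 1, vs 3), s(vs 1, vs 4), s(vs 2, vs 3), s(vs 2, vs 4)}
    ∪ {s(us 3, vs 4), s(vs 4, us 4), s(us 4, vs 3), s(vs 3, us 3)}
  | k + 2 =>
    let i := k + 2
    (famGEdges (k + 1) \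
      {s(us (2*i-1), vs (2*i)), s(vs (2*i), us (2*i)),
        s(us (2*i), vs (2*i-1)), s(vs (2*i-1), us (2*i-1))})
    ∪ {s(us (2*i-1), us (2*i+1)), s(us (2*i-1), us (2*i+2)),
      s(us (2*i), us (2*i+1)), s(us (2*i), us (2*i+2))}
    ∪ {s(vs (2*i-1), vs (2*i+1)), s(vs (2*i-1), vs (2*i+2)),
      s(vs (2*i), vs (2*i+1)), s(vs (2*i), vs (2*i+2))}
    ∪ {s(us (2*i+1), vs (2*i+2)), s(vs (2*i+2), us (2*i+2)),
      s(us (2*i+2), vs (2*i+1)), s(vs (2*i+1), us (2*i+1))}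

/-- The graph `𝓖_i`, for `i ≥ 1`. -/
def famG (i : ℕ) : SimpleGraph (famGVerts i) :=
  (SimpleGraph.fromEdgeSet (famGEdges i)).induce (famGVerts i)

/-- Vertex set of `𝓗_j` for `j ≥ 1` (the value at `0` is a dummy). -/
def famHVerts : ℕ → Set Vtx
  | 0 => ∅
  | 1 => {u, v} ∪ {us 1, us 2, vs 1, vs 2} ∪ {us 3, us 4}
  | k + 2 =>
    let j := k + 2
    famHVerts (k + 1) ∪ {vs (2*j-1), vs (2*j), us (2*j+1), us (2*j+2)}

/-- Edge set of `𝓗_j` for `j ≥ 1` (the value at `0` is a dummy). -/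
def famHEdges : ℕ → Set (Sym2 Vtx)
  | 0 => ∅
  | 1 =>
    {s(u, us 1), s(u, us 2), s(u, vs 1), s(u, vs 2),
      s(v, us 1), s(v, us 2), s(v, vs 1), s(v, vs 2)}
    ∪ {s(us 1, us 3), s(us 1, us 4), s(us 2, us 3), s(us 2, us 4),
      s(vs 1, us 3), s(vs 1, us 4), s(vs 2, us 3), s(vs 2, us 4)}
  | k + 2 =>
    let j := k + 2
    (famHEdges (k + 1) \
      {s(vs (2*j-3), us (2*j-1)), s(vs (2*j-3), us (2*j)),
        s(vs (2*j-2), us (2*j-1)), s(vs (2*j-2), us (2*j))})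
    ∪ {s(vs (2*j-3), vs (2*j-1)), s(vs (2*j-3), vs (2*j)),
      s(vs (2*j-2), vs (2*j-1)), s(vs (2*j-2), vs (2*j))}
    ∪ {s(us (2*j-1), us (2*j+1)), s(us (2*j-1), us (2*j+2)),
      s(us (2*j), us (2*j+1)), s(us (2*j), us (2*j+2))}
    ∪ {s(vs (2*j-1), us (2*j+1)), s(vs (2*j-1), us (2*j+2)),
      s(vs (2*j), us (2*j+1)), s(vs (2*j), us (2*j+2))}

/-- The graph `𝓗_j`, for `j ≥ 1`. -/
def famH (j : ℕ) : SimpleGraph (famHVerts j) :=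
  (SimpleGraph.fromEdgeSet (famHEdges j)).induce (famHVerts j)

/-- `G` is, up to isomorphism, one of the graphs of the class `𝓕`. -/
def InF {V : Type*} (G : SimpleGraph V) : Prop :=
  Nonempty (G ≃g graphG1) ∨ Nonempty (G ≃g graphG2) ∨ Nonempty (G ≃g graphG3) ∨
    Nonempty (G ≃g graphQ4) ∨
    (∃ i : ℕ, 1 ≤ i ∧ Nonempty (G ≃g famG i)) ∨
    (∃ j : ℕ, 1 ≤ j ∧ Nonempty (G ≃g famH j))

end OptimumSkew

/-!
An orientation `σ` of a `4`-regular graph on `n` vertices is optimum exactly when all eigenvalues of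
`S = S(σ)` have modulus `2`: `S` is skew-symmetric, hence unitarily diagonalizable, its eigenvalues
satisfy `∑ |λ|² = tr (Sᵀ S) = 4 n`, and `∑ (|λ| - 2)² = 8 n - 4 ∑ |λ|`. This is the condition
`Sᵀ S = 4 I` (`GraphOrientation.isOptimum_iff`).

If `Sᵀ S = 4 I`, the rows of `S` at two distinct vertices are orthogonal. Their scalar product has one
term `±1` for every common neighbour, so two distinct vertices have an even number of common
neighbours (`isEvenQuartic_of_orientation`). This alone determines the connected graphs
(`IsEvenQuartic.inF`).

* Suppose that two vertices have the same neighbours. By parity and connectedness every vertex then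
  has such a twin (`IsEvenQuartic.exists_twin_of_adj`). Three mutual twins give `K_{4,4}`; otherwise
  the twin pairs are the vertices of a connected `2`-regular graph. In both cases the graph is a
  cycle of length `m ≥ 3` with every vertex replaced by a pair of nonadjacent vertices
  (`blownUpCycle`). The octahedron is the case `m = 3`, `𝓖_i` the case `m = 2 i + 3`, and `𝓗_j` the
  case `m = 2 j + 2`.
* Suppose that there are no twins. Two vertices then have no or exactly two common neighbours. A
  triangle generates `G₁`. Without triangles, the layers around a vertex `x` with neighbours
  `a, b, c, d` are explicit: the second layer is the set of edges of the complete graph on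
  `{a, b, c, d}`, and the third layer consists of triangles or `4`-cycles of this `K₄`, such that
  two incident edges are together in exactly one of them. Four triangles give the hypercube, three
  `4`-cycles give `G₃`.

In the classification, a graph is recognized by an injective homomorphism from the model, which must be an
isomorphism because both graphs are `4`-regular and the target is connected
(`IsEvenQuartic.nonempty_iso`). Conversely, every graph of the class has an explicit orientation with
`Sᵀ S = 4 I` (`InF.hasOrthogonalSigning`).
-/

/-! ### Skew energy and singular values -/

namespace OptimumSkew

open Matrix Complex

variable {V : Type*} [Fintype V] [DecidableEq V]

theorem exists_diagonalization_of_conjTranspose_eq_neg (S : Matrix V V ℂ) (hS : Sᴴ = -S) :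
    ∃ (U : Matrix V V ℂ) (d : V → ℝ), star U * U = 1 ∧ U * star U = 1 ∧
      S = U * diagonal (fun i => -I * (d i : ℂ)) * star U := by
  have hA : (I • S).IsHermitian := by
    rw [Matrix.IsHermitian, conjTranspose_smul, hS]
    simp
  refine ⟨hA.eigenvectorUnitary, hA.eigenvalues, by simp, by simp, ?_⟩
  have h := hA.spectral_theorem
  rw [Unitary.conjStarAlgAut_apply] at h
  have h2 : diagonal (fun i => -I * (hA.eigenvalues i : ℂ)) =
      (-I) • diagonal ((RCLike.ofReal : ℝ → ℂ) ∘ hA.eigenvalues) := by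
    ext i j
    by_cases hij : i = j
    · subst hij; simp
    · simp [hij]
  rw [h2, Matrix.mul_smul, Matrix.smul_mul, ← h, smul_smul]
  simp

/-- The sum of the moduli of the eigenvalues of a skew-Hermitian matrix of order `n` with
`tr (Sᴴ S) = 4 n` is `2 n` exactly when all eigenvalues have modulus `2`. -/
theorem sum_norm_roots_eq_two_mul_card_iff (S : Matrix V V ℂ) (hS : Sᴴ = -S)
    (htr : (Sᴴ * S).trace = 4 * (Fintype.card V : ℂ)) :
    (S.charpoly.roots.map fun z => ‖z‖).sum = 2 * (Fintype.card V : ℝ) ↔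
      Sᴴ * S = (4 : ℂ) • (1 : Matrix V V ℂ) := by
  obtain ⟨U, d, hU1, hU2, hSU⟩ := exists_diagonalization_of_conjTranspose_eq_neg S hS
  have hroots : (S.charpoly.roots.map fun z => ‖z‖).sum = ∑ i, |d i| := by
    have hc : S.charpoly = (diagonal (fun i => -I * (d i : ℂ))).charpoly := by
      rw [hSU, Matrix.charpoly_mul_comm, ← Matrix.mul_assoc, hU1, Matrix.one_mul]
    rw [hc, charpoly_diagonal, Polynomial.roots_prod]
    · simp only [Polynomial.roots_X_sub_C]
      simp
    · exact Finset.prod_ne_zero_iff.2 fun i _ => Polynomial.X_sub_C_ne_zero _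
  have hsq : Sᴴ * S = U * diagonal (fun i => ((d i ^ 2 : ℝ) : ℂ)) * star U := by
    have h1 : S * S = U * (diagonal (fun i => -I * (d i : ℂ)) *
        diagonal (fun i => -I * (d i : ℂ))) * star U := by
      conv_lhs => rw [hSU]
      calc _ = U * diagonal (fun i => -I * (d i : ℂ)) * (star U * U) *
            diagonal (fun i => -I * (d i : ℂ)) * star U := by noncomm_ring
        _ = _ := by rw [hU1]; noncomm_ring
    rw [hS, Matrix.neg_mul, h1, diagonal_mul_diagonal, ← Matrix.neg_mul, ← Matrix.mul_neg,
      diagonal_neg]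
    congr 3
    ext i
    push_cast
    linear_combination (-(d i : ℂ) ^ 2) * Complex.I_mul_I
  have hsum : ∑ i, d i ^ 2 = 4 * (Fintype.card V : ℝ) := by
    rw [hsq, Matrix.trace_mul_comm, ← Matrix.mul_assoc, hU1, Matrix.one_mul,
      trace_diagonal] at htr
    exact_mod_cast htr
  -- `∑ (|dᵢ| - 2)² = ∑ dᵢ² - 4 ∑ |dᵢ| + 4 n`, so the bound is attained when all terms vanish.
  have hkey : ∑ i, (|d i| - 2) ^ 2 = 8 * (Fintype.card V : ℝ) - 4 * ∑ i, |d i| := by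
    have : ∀ i, (|d i| - 2) ^ 2 = d i ^ 2 - 4 * |d i| + 4 := fun i => by
      rw [← sq_abs (d i)]; ring
    simp only [this, Finset.sum_add_distrib, Finset.sum_sub_distrib, ← Finset.mul_sum, hsum]
    simp
    ring
  rw [hroots]
  have hiff : (∑ i, |d i| = 2 * (Fintype.card V : ℝ)) ↔ ∀ i, d i ^ 2 = 4 := by
    constructor
    · intro h i
      have h0 : ∑ i, (|d i| - 2) ^ 2 = 0 := by rw [hkey, h]; ring
      have := (Finset.sum_eq_zero_iff_of_nonneg fun i _ => sq_nonneg (|d i| - 2)).1 h0 i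
        (Finset.mem_univ i)
      have h2 : |d i| = 2 := by nlinarith
      rw [← sq_abs, h2]; norm_num
    · intro h
      have h2 : ∀ i, |d i| = 2 := fun i => by
        have := h i
        rw [← sq_abs] at this
        nlinarith [abs_nonneg (d i)]
      simp [h2, mul_comm]
  rw [hiff, hsq]
  constructor
  · intro h
    have : diagonal (fun i => ((d i ^ 2 : ℝ) : ℂ)) = (4 : ℂ) • (1 : Matrix V V ℂ) := by
      rw [smul_one_eq_diagonal]
      congr 1
      ext i
      rw [h i]; norm_num
    rw [this, Matrix.mul_smul, Matrix.smul_mul, Matrix.mul_one, hU2]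
  · intro h i
    have h2 : diagonal (fun i => ((d i ^ 2 : ℝ) : ℂ)) = (4 : ℂ) • (1 : Matrix V V ℂ) := by
      calc diagonal (fun i => ((d i ^ 2 : ℝ) : ℂ))
          = (star U * U) * diagonal (fun i => ((d i ^ 2 : ℝ) : ℂ)) * (star U * U) := by
            rw [hU1]; simp
        _ = star U * (U * diagonal (fun i => ((d i ^ 2 : ℝ) : ℂ)) * star U) * U := by
            simp only [Matrix.mul_assoc]
        _ = _ := by rw [h, Matrix.mul_smul, Matrix.smul_mul, Matrix.mul_one, hU1]
    have h3 := congrFun (congrFun h2 i) i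
    simp only [diagonal_apply_eq, Matrix.smul_apply, one_apply_eq, smul_eq_mul, mul_one] at h3
    exact_mod_cast h3

namespace GraphOrientation

variable {G : SimpleGraph V} (σ : GraphOrientation G)

theorem skewAdjMatrix_swap {W : Type*} {H : SimpleGraph W} (τ : GraphOrientation H)
    (R : Type*) [Ring R] (x y : W) :
    τ.skewAdjMatrix R x y = -τ.skewAdjMatrix R y x := by
  have := τ.asymm x y
  by_cases h1 : τ.arc x y <;> by_cases h2 : τ.arc y x <;> simp_all [skewAdjMatrix]

theorem skewAdjMatrix_sq {W : Type*} {H : SimpleGraph W} [DecidableRel H.Adj]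
    (τ : GraphOrientation H) (R : Type*) [Ring R] (x y : W) :
    τ.skewAdjMatrix R x y * τ.skewAdjMatrix R x y = if H.Adj x y then 1 else 0 := by
  have := τ.adj_iff x y
  by_cases h1 : τ.arc x y <;> by_cases h2 : τ.arc y x <;> simp_all [skewAdjMatrix]

theorem skewAdjMatrix_map {W : Type*} {H : SimpleGraph W} (τ : GraphOrientation H)
    {R R' : Type*} [Ring R] [Ring R'] (f : R →+* R') :
    (τ.skewAdjMatrix R).map f = τ.skewAdjMatrix R' := by
  ext x y
  by_cases h1 : τ.arc x y <;> by_cases h2 : τ.arc y x <;> simp_all [skewAdjMatrix]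

theorem isOptimum_iff [DecidableRel G.Adj] [Nonempty V] (hreg : G.IsRegularOfDegree 4) :
    σ.IsOptimum ↔
      (σ.skewAdjMatrix ℝ)ᵀ * σ.skewAdjMatrix ℝ = (4 : ℝ) • (1 : Matrix V V ℝ) := by
  have hreal : (σ.skewAdjMatrix ℝ).map (algebraMap ℝ ℂ) = σ.skewAdjMatrix ℂ :=
    σ.skewAdjMatrix_map (algebraMap ℝ ℂ)
  have hH : (σ.skewAdjMatrix ℂ)ᴴ = (σ.skewAdjMatrix ℂ)ᵀ := by
    rw [← hreal]; ext x y; simp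
  have hskew : (σ.skewAdjMatrix ℂ)ᴴ = -σ.skewAdjMatrix ℂ := by
    rw [hH]; ext x y; simp [σ.skewAdjMatrix_swap ℂ y x]
  have htr : ((σ.skewAdjMatrix ℂ)ᴴ * σ.skewAdjMatrix ℂ).trace = 4 * (Fintype.card V : ℂ) := by
    have : ∀ x, ((σ.skewAdjMatrix ℂ)ᴴ * σ.skewAdjMatrix ℂ) x x = 4 := fun x => by
      rw [hH]
      simp only [Matrix.mul_apply, transpose_apply, skewAdjMatrix_sq, SimpleGraph.adj_comm _ _ x]
      have := hreg.degree_eq x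
      rw [← G.card_neighborFinset_eq_degree, SimpleGraph.neighborFinset_eq_filter] at this
      rw [Finset.sum_boole, this]
      norm_num
    simp [Matrix.trace, Matrix.diag, this, mul_comm]
  have h4 : Real.sqrt ((G.maxDegree : ℕ) : ℝ) = 2 := by
    rw [hreg.maxDegree_eq]
    rw [show ((4 : ℕ) : ℝ) = 2 ^ 2 by norm_num]
    exact Real.sqrt_sq (by norm_num)
  rw [IsOptimum, skewEnergy, h4, mul_comm _ (2 : ℝ),
    sum_norm_roots_eq_two_mul_card_iff _ hskew htr, hH, ← hreal]
  have e1 : ((σ.skewAdjMatrix ℝ).map (algebraMap ℝ ℂ))ᵀ *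
      (σ.skewAdjMatrix ℝ).map (algebraMap ℝ ℂ) =
      ((σ.skewAdjMatrix ℝ)ᵀ * σ.skewAdjMatrix ℝ).map (algebraMap ℝ ℂ) := by
    rw [Matrix.map_mul, Matrix.transpose_map]
  have e2 : (4 : ℂ) • (1 : Matrix V V ℂ) =
      ((4 : ℝ) • (1 : Matrix V V ℝ)).map (algebraMap ℝ ℂ) := by
    ext i j
    by_cases h : i = j <;> simp [h]
  rw [e1, e2]
  exact (Matrix.map_injective (algebraMap ℝ ℂ).injective).eq_iff

end GraphOrientation

end OptimumSkew

/-! ### Orthogonal signings of the graphs of the class -/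

namespace OptimumSkew

open Matrix

/-- `G` carries an integral skew-symmetric signing with orthogonal rows of square norm `4`:
the matrix form of an orientation `σ` of `G` with `S(σ)ᵀ S(σ) = 4 I`. -/
def HasOrthogonalSigning {V : Type*} [Fintype V] [DecidableEq V] (G : SimpleGraph V) : Prop :=
  ∃ M : V → V → ℤ, (∀ x y, M x y = -M y x) ∧ (∀ x y, M x y = 0 ∨ M x y = 1 ∨ M x y = -1) ∧
    (∀ x y, G.Adj x y ↔ M x y ≠ 0) ∧ ∀ x y, ∑ z, M x z * M y z = if x = y then 4 else 0

variable {V W : Type*} [Fintype V] [DecidableEq V] [Fintype W] [DecidableEq W]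

theorem HasOrthogonalSigning.of_iso {G : SimpleGraph V} {H : SimpleGraph W}
    (h : HasOrthogonalSigning H) (φ : G ≃g H) : HasOrthogonalSigning G := by
  obtain ⟨M, h1, h2, h3, h4⟩ := h
  refine ⟨fun x y => M (φ x) (φ y), fun x y => h1 _ _, fun x y => h2 _ _, fun x y => ?_,
    fun x y => ?_⟩
  · rw [← h3, φ.map_adj_iff]
  · have := φ.toEquiv.sum_comp (fun z => M (φ x) z * M (φ y) z)
    refine this.trans ?_
    rw [h4]
    simp

theorem HasOrthogonalSigning.exists_orientation {G : SimpleGraph V}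
    (h : HasOrthogonalSigning G) : ∃ σ : GraphOrientation G,
      (σ.skewAdjMatrix ℝ)ᵀ * σ.skewAdjMatrix ℝ = (4 : ℝ) • (1 : Matrix V V ℝ) := by
  obtain ⟨M, h1, h2, h3, h4⟩ := h
  let σ : GraphOrientation G :=
    { arc := fun x y => M x y = 1
      adj_iff := fun x y => by
        have := h1 x y
        have := h2 x y
        rw [h3]
        omega
      asymm := fun x y h h' => by
        have := h1 x y
        omega }
  refine ⟨σ, ?_⟩
  have hM : ∀ x y, σ.skewAdjMatrix ℝ x y = ((M x y : ℤ) : ℝ) := by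
    intro x y
    have e1 := h1 y x
    rcases h2 x y with h | h | h <;>
      simp [σ, GraphOrientation.skewAdjMatrix, h, e1]
  ext x y
  simp only [Matrix.mul_apply, transpose_apply, hM, Matrix.smul_apply, smul_eq_mul]
  have := h4 x y
  simp_rw [h1 x, h1 y] at this
  have h5 := congrArg (fun t : ℤ => (t : ℝ)) this
  simp only [neg_mul_neg] at h5
  push_cast at h5
  rw [h5, Matrix.one_apply]
  split_ifs <;> simp

/-- The signing with value `1` on the listed arcs and `-1` on their reversals. -/
def signOfArcs (l : List (V × V)) (x y : V) : ℤ :=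
  if (x, y) ∈ l then 1 else if (y, x) ∈ l then -1 else 0

theorem hasOrthogonalSigning_graphG1 : HasOrthogonalSigning graphG1 := by
  let l : List (Fin 8 × Fin 8) := [(0, 1), (0, 2), (0, 3), (1, 2), (3, 1), (2, 3), (4, 5), (4, 6),
    (4, 7), (6, 5), (5, 7), (7, 6), (0, 4), (5, 1), (6, 2), (7, 3)]
  refine ⟨signOfArcs l, by decide +kernel, by decide +kernel, ?_, by decide +kernel⟩
  simp only [graphG1, SimpleGraph.fromEdgeSet_adj, Set.mem_insert_iff, Set.mem_singleton_iff]
  decide +kernel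

theorem hasOrthogonalSigning_graphG3 : HasOrthogonalSigning graphG3 := by
  let l : List (Fin 14 × Fin 14) := [(0, 1), (0, 2), (0, 3), (0, 4), (1, 5), (1, 6), (1, 7), (5, 2),
    (2, 8), (2, 9), (6, 3), (8, 3), (3, 10), (7, 4), (9, 4), (10, 4), (5, 11), (5, 12), (11, 6),
    (6, 13), (12, 7), (13, 7), (8, 12), (13, 8), (9, 11), (9, 13), (11, 10), (10, 12)]
  refine ⟨signOfArcs l, by decide +kernel, by decide +kernel, ?_, by decide +kernel⟩
  simp only [graphG3, SimpleGraph.fromEdgeSet_adj, Set.mem_insert_iff, Set.mem_singleton_iff]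
  decide +kernel

/-- The edge of the hypercube in direction `i` at a word `x` is directed from `xᵢ = 0` to
`xᵢ = 1`, with the direction reversed when `x₀ + ⋯ + xᵢ₋₁` is odd; the direction matrices then
anticommute pairwise. -/
theorem hasOrthogonalSigning_graphQ4 : HasOrthogonalSigning graphQ4 := by
  refine ⟨fun x y => if hammingDist x y = 1 then
    ∏ i, (if x i = y i then ∏ j, (if i < j ∧ x j ≠ y j ∧ x i then -1 else 1)
      else if x i then -1 else 1) else 0,
    by decide +kernel, by decide +kernel, ?_, by decide +kernel⟩
  simp only [graphQ4]
  decide +kernel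

/-- The lexicographic product of the cycle of length `m ≥ 3` with two isolated vertices: every
vertex of the cycle is replaced by a pair of vertices, every edge by a complete bipartite graph. -/
def blownUpCycle (m : ℕ) : SimpleGraph (ZMod m × Bool) :=
  SimpleGraph.fromRel fun p q => q.1 = p.1 + 1

theorem blownUpCycle_adj {m : ℕ} (hm : 2 ≤ m) (p q : ZMod m × Bool) :
    (blownUpCycle m).Adj p q ↔ q.1 = p.1 + 1 ∨ p.1 = q.1 + 1 := by
  have : Fact (1 < m) := ⟨hm⟩
  rw [blownUpCycle, SimpleGraph.fromRel_adj, and_iff_right_iff_imp]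
  rintro h rfl
  simp at h

/-- Between consecutive pairs the signing is the rank-one block with rows `(1, -1)`; consecutive
blocks multiply to zero. -/
theorem hasOrthogonalSigning_blownUpCycle {m : ℕ} [NeZero m] (hm : 3 ≤ m) :
    HasOrthogonalSigning (blownUpCycle m) := by
  have h2 : (2 : ZMod m) ≠ 0 := fun h => by
    have := (ZMod.natCast_eq_zero_iff 2 m).1 (by exact_mod_cast h)
    exact absurd (Nat.le_of_dvd (by norm_num) this) (by omega)
  have hne : ∀ a b : ZMod m, b = a + 1 → a ≠ b + 1 := by
    rintro a b rfl h
    exact h2 (by linear_combination -h)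
  let ε : Bool → ℤ := fun b => if b then -1 else 1
  have hε : ∀ b, ε b = 1 ∨ ε b = -1 := by decide
  have hεε : ∀ b c, 2 * (1 + ε b * ε c) = if b = c then 4 else 0 := by decide
  refine ⟨fun p q => (if q.1 = p.1 + 1 then ε q.2 else 0) - (if p.1 = q.1 + 1 then ε p.2 else 0),
    fun p q => by ring, fun p q => ?_, fun p q => ?_, fun p q => ?_⟩
  · have := hne p.1 q.1
    rcases hε p.2 with h | h <;> rcases hε q.2 with h' | h' <;> simp only [h, h'] <;>
      split_ifs with a b <;> first | exact absurd b (this a) | norm_num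
  · rw [blownUpCycle_adj (by omega)]
    have := hne p.1 q.1
    rcases hε p.2 with h | h <;> rcases hε q.2 with h' | h' <;> simp only [h, h'] <;>
      grind
  · rw [Fintype.sum_prod_type]
    have key : ∀ z : ZMod m, ∑ b : Bool,
        ((if z = p.1 + 1 then ε b else 0) - (if p.1 = z + 1 then ε p.2 else 0)) *
        ((if z = q.1 + 1 then ε b else 0) - (if q.1 = z + 1 then ε q.2 else 0)) =
        (if z = p.1 + 1 then (if z = q.1 + 1 then 2 else 0) else 0) +
        (if z = p.1 - 1 then (if z = q.1 - 1 then 2 * (ε p.2 * ε q.2) else 0) else 0) := by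
      intro z
      have e1 : ∀ w : ZMod m, w = z + 1 ↔ z = w - 1 := fun w =>
        ⟨fun h => by rw [h]; ring, fun h => by rw [h]; ring⟩
      simp only [e1, Fintype.sum_bool, show ε true = -1 from rfl, show ε false = 1 from rfl]
      split_ifs <;> ring
    simp only [key, Finset.sum_add_distrib, Finset.sum_ite_eq', Finset.mem_univ, if_true,
      add_left_inj, sub_left_inj]
    have := hεε p.2 q.2
    simp only [Prod.ext_iff]
    split_ifs at this ⊢ <;> first | omega | simp_all

end OptimumSkew

/-! ### The two families as blown-up cycles -/

namespace OptimumSkew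

open Vtx

/-- The position of a name along the cycle of pairs: `{u, v}` is at `0`, the pair `U_k` at `k`
and the pair `V_k` at `-k`. -/
def Vtx.level : Vtx → ℤ
  | .u => 0
  | .v => 0
  | .us n => ((n + 1) / 2 : ℕ)
  | .vs n => -((n + 1) / 2 : ℕ)

/-- Which of the two members of its pair a name is. -/
def Vtx.bit : Vtx → Bool
  | .u => false
  | .v => true
  | .us n => n % 2 = 0
  | .vs n => n % 2 = 0

/-- `w` is one of `u, v`, a member of `U_1, …, U_p` or a member of `V_1, …, V_q`. -/
def Vtx.InRange (p q : ℕ) : Vtx → Prop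
  | .u => True
  | .v => True
  | .us n => 1 ≤ n ∧ n ≤ 2 * p
  | .vs n => 1 ≤ n ∧ n ≤ 2 * q

/-- Adjacency along the cycle of pairs `V_q, …, V_1, {u, v}, U_1, …, U_p`, which closes up from
`U_p` to `V_q`. -/
def Vtx.Linked (p q : ℕ) (a b : Vtx) : Prop :=
  b.level = a.level + 1 ∨ a.level = b.level + 1 ∨
    (a.level = p ∧ b.level = -q) ∨ (b.level = p ∧ a.level = -q)

theorem mem_famGVerts (k : ℕ) (w : Vtx) : w ∈ famGVerts (k + 1) ↔ w.InRange (k + 2) (k + 2) := by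
  induction k with
  | zero => cases w <;> simp [famGVerts, Vtx.InRange] <;> omega
  | succ k ih =>
    simp only [famGVerts, Set.mem_union, ih]
    cases w <;> simp [Vtx.InRange] <;> omega

theorem mem_famHVerts (k : ℕ) (w : Vtx) : w ∈ famHVerts (k + 1) ↔ w.InRange (k + 2) (k + 1) := by
  induction k with
  | zero => cases w <;> simp [famHVerts, Vtx.InRange] <;> omega
  | succ k ih =>
    simp only [famHVerts, Set.mem_union, ih]
    cases w <;> simp [Vtx.InRange] <;> omega

/-- The four edges of the complete bipartite graph between two pairs. -/
theorem mem_pair_join (p p' r r' a b : Vtx) :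
    s(a, b) ∈ ({s(p, r), s(p, r'), s(p', r), s(p', r')} : Set (Sym2 Vtx)) ↔
      ((a = p ∨ a = p') ∧ (b = r ∨ b = r')) ∨ ((b = p ∨ b = p') ∧ (a = r ∨ a = r')) := by
  simp only [Set.mem_insert_iff, Set.mem_singleton_iff, Sym2.eq_iff]
  tauto

/-- The same edges, listed in cyclic order. -/
theorem mem_pair_join' (p p' r r' a b : Vtx) :
    s(a, b) ∈ ({s(p, r'), s(r', p'), s(p', r), s(r, p)} : Set (Sym2 Vtx)) ↔
      ((a = p ∨ a = p') ∧ (b = r ∨ b = r')) ∨ ((b = p ∨ b = p') ∧ (a = r ∨ a = r')) := by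
  simp only [Set.mem_insert_iff, Set.mem_singleton_iff, Sym2.eq_iff]
  tauto

/-- The eight edges between two pairs and a third one. -/
theorem mem_pair_join_pairs (p p' r r' t t' a b : Vtx) :
    s(a, b) ∈ ({s(p, r), s(p, r'), s(p, t), s(p, t'), s(p', r), s(p', r'), s(p', t), s(p', t')} :
      Set (Sym2 Vtx)) ↔
      (((a = p ∨ a = p') ∧ (b = r ∨ b = r')) ∨ ((b = p ∨ b = p') ∧ (a = r ∨ a = r'))) ∨
      (((a = p ∨ a = p') ∧ (b = t ∨ b = t')) ∨ ((b = p ∨ b = p') ∧ (a = t ∨ a = t'))) := by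
  rw [← mem_pair_join, ← mem_pair_join]
  simp only [Set.mem_insert_iff, Set.mem_singleton_iff]
  tauto

/-- The two joins `p * r` and `t * s` of pairs. -/
theorem mem_two_pair_joins (p p' r r' t t' s s' a b : Vtx) :
    s(a, b) ∈ ({s(p, r), s(p, r'), s(p', r), s(p', r'), s(t, s), s(t, s'), s(t', s), s(t', s')} :
      Set (Sym2 Vtx)) ↔
      (((a = p ∨ a = p') ∧ (b = r ∨ b = r')) ∨ ((b = p ∨ b = p') ∧ (a = r ∨ a = r'))) ∨
      (((a = t ∨ a = t') ∧ (b = s ∨ b = s')) ∨ ((b = t ∨ b = t') ∧ (a = s ∨ a = s'))) := by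
  rw [← mem_pair_join, ← mem_pair_join, ← Set.mem_union]
  simp only [Set.insert_union, Set.singleton_union]

/-- The index of a name is only seen through the index `(n + 1) / 2` of its pair. -/
theorem eq_odd_or_eq_even_iff {n c c' r : ℕ} (hc : c + 1 = 2 * r) (hc' : c' = 2 * r) :
    (n = c ∨ n = c') ↔ (n + 1) / 2 = r := by
  omega

theorem one_le_and_le_two_mul_iff (n p : ℕ) :
    (1 ≤ n ∧ n ≤ 2 * p) ↔ (1 ≤ (n + 1) / 2 ∧ (n + 1) / 2 ≤ p) := by
  omega

/-- Closed form of the edge set: the edges deleted at each step are those closing the cycle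
between the pairs `U_p` and `V_p` that were last before. -/
theorem mem_famGEdges (k : ℕ) (a b : Vtx) : s(a, b) ∈ famGEdges (k + 1) ↔
    a.InRange (k + 2) (k + 2) ∧ b.InRange (k + 2) (k + 2) ∧ a.Linked (k + 2) (k + 2) b := by
  induction k with
  | zero =>
    have h1 : ∀ n, (n = 1 ∨ n = 2) ↔ (n + 1) / 2 = 1 := fun n =>
      eq_odd_or_eq_even_iff rfl rfl
    have h2 : ∀ n, (n = 3 ∨ n = 4) ↔ (n + 1) / 2 = 2 := fun n =>
      eq_odd_or_eq_even_iff rfl rfl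
    simp only [zero_add, famGEdges, Set.mem_union, mem_pair_join_pairs,
      mem_two_pair_joins, mem_pair_join']
    cases a <;> cases b <;>
      simp only [Vtx.us.injEq, Vtx.vs.injEq, reduceCtorEq, false_and, and_false, or_false,
        false_or, or_self, and_self, true_and, eq_self, or_true, Vtx.InRange, Vtx.Linked,
        Vtx.level, h1, h2, one_le_and_le_two_mul_iff] <;> first | omega | norm_num
  | succ k ih =>
    have h1 : ∀ n, (n = 2 * (k + 2) - 1 ∨ n = 2 * (k + 2)) ↔ (n + 1) / 2 = k + 2 :=
      fun n => eq_odd_or_eq_even_iff (by omega) (by omega)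
    have h2 : ∀ n, (n = 2 * (k + 2) + 1 ∨ n = 2 * (k + 2) + 2) ↔ (n + 1) / 2 = k + 3 :=
      fun n => eq_odd_or_eq_even_iff (by omega) (by omega)
    simp only [famGEdges, Set.mem_union, Set.mem_sdiff, ih, mem_pair_join, mem_pair_join']
    cases a <;> cases b <;>
      simp only [Vtx.us.injEq, Vtx.vs.injEq, reduceCtorEq, false_and, and_false, or_false,
        false_or, or_self, true_and, and_true, not_false_eq_true, Vtx.InRange, Vtx.Linked,
        Vtx.level, h1, h2, one_le_and_le_two_mul_iff] <;> omega

/-- Closed form of the edge set: the edges deleted at each step are those closing the cycle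
between the pairs `U_p` and `V_q` that were last before. -/
theorem mem_famHEdges (k : ℕ) (a b : Vtx) : s(a, b) ∈ famHEdges (k + 1) ↔
    a.InRange (k + 2) (k + 1) ∧ b.InRange (k + 2) (k + 1) ∧ a.Linked (k + 2) (k + 1) b := by
  induction k with
  | zero =>
    have h1 : ∀ n, (n = 1 ∨ n = 2) ↔ (n + 1) / 2 = 1 := fun n =>
      eq_odd_or_eq_even_iff rfl rfl
    have h2 : ∀ n, (n = 3 ∨ n = 4) ↔ (n + 1) / 2 = 2 := fun n =>
      eq_odd_or_eq_even_iff rfl rfl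
    simp only [zero_add, famHEdges, Set.mem_union, mem_pair_join_pairs, mem_two_pair_joins]
    cases a <;> cases b <;>
      simp only [Vtx.us.injEq, Vtx.vs.injEq, reduceCtorEq, false_and, and_false, or_false,
        false_or, or_self, and_self, true_and, eq_self, or_true, Vtx.InRange, Vtx.Linked,
        Vtx.level, h1, h2, one_le_and_le_two_mul_iff] <;> first | omega | (norm_num <;> omega)
  | succ k ih =>
    have h1 : ∀ n, (n = 2 * (k + 2) - 3 ∨ n = 2 * (k + 2) - 2) ↔ (n + 1) / 2 = k + 1 :=
      fun n => eq_odd_or_eq_even_iff (by omega) (by omega)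
    have h2 : ∀ n, (n = 2 * (k + 2) - 1 ∨ n = 2 * (k + 2)) ↔ (n + 1) / 2 = k + 2 :=
      fun n => eq_odd_or_eq_even_iff (by omega) (by omega)
    have h3 : ∀ n, (n = 2 * (k + 2) + 1 ∨ n = 2 * (k + 2) + 2) ↔ (n + 1) / 2 = k + 3 :=
      fun n => eq_odd_or_eq_even_iff (by omega) (by omega)
    simp only [famHEdges, Set.mem_union, Set.mem_sdiff, ih, mem_pair_join]
    cases a <;> cases b <;>
      simp only [Vtx.us.injEq, Vtx.vs.injEq, reduceCtorEq, false_and, and_false, or_false,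
        false_or, or_self, true_and, and_true, not_false_eq_true, Vtx.InRange, Vtx.Linked,
        Vtx.level, h1, h2, h3, one_le_and_le_two_mul_iff] <;> omega

theorem Vtx.InRange.level_bounds {p q : ℕ} {w : Vtx} (h : w.InRange p q) :
    -q ≤ w.level ∧ w.level ≤ p := by
  cases w <;> simp [Vtx.InRange, Vtx.level] at h ⊢ <;> omega

theorem Vtx.ext_level_bit {p q : ℕ} {a b : Vtx} (ha : a.InRange p q) (hb : b.InRange p q)
    (hl : a.level = b.level) (hbit : a.bit = b.bit) : a = b := by
  cases a <;> cases b <;> simp [Vtx.InRange, Vtx.level, Vtx.bit] at ha hb hl hbit ⊢ <;> omega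

theorem Vtx.exists_level_bit {p q : ℕ} (l : ℤ) (h1 : -q ≤ l) (h2 : l ≤ p) (c : Bool) :
    ∃ w : Vtx, w.InRange p q ∧ w.level = l ∧ w.bit = c := by
  rcases lt_trichotomy l 0 with h | h | h
  · cases c
    · exact ⟨.vs (2 * l.natAbs - 1), by simp only [InRange]; omega, by simp only [level]; omega,
        by simp only [bit, decide_eq_false_iff_not]; omega⟩
    · exact ⟨.vs (2 * l.natAbs), by simp only [InRange]; omega, by simp only [level]; omega,
        by simp [bit]⟩
  · cases c
    · exact ⟨.u, trivial, h.symm, rfl⟩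
    · exact ⟨.v, trivial, h.symm, rfl⟩
  · cases c
    · exact ⟨.us (2 * l.natAbs - 1), by simp only [InRange]; omega, by simp only [level]; omega,
        by simp only [bit, decide_eq_false_iff_not]; omega⟩
    · exact ⟨.us (2 * l.natAbs), by simp only [InRange]; omega, by simp only [level]; omega,
        by simp [bit]⟩

theorem nonempty_iso_blownUpCycle {p q : ℕ} (hp : 1 ≤ p) (hq : 1 ≤ q)
    (X : Set Vtx) (E : Set (Sym2 Vtx)) (hX : ∀ w, w ∈ X ↔ w.InRange p q)
    (hE : ∀ a b, s(a, b) ∈ E ↔ a.InRange p q ∧ b.InRange p q ∧ a.Linked p q b) :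
    Nonempty ((SimpleGraph.fromEdgeSet E).induce X ≃g blownUpCycle (p + q + 1)) := by
  set m := p + q + 1 with hm
  let f : X → ZMod m × Bool := fun w => ((w.1.level : ZMod m), w.1.bit)
  have hcast : ∀ a b : ℤ, (a : ZMod m) = b ↔ (m : ℤ) ∣ b - a :=
    fun a b => ZMod.intCast_eq_intCast_iff_dvd_sub a b m
  have hf : Function.Bijective f := by
    constructor
    · rintro ⟨a, ha⟩ ⟨b, hb⟩ hab
      rw [hX] at ha hb
      simp only [f, Prod.mk.injEq, hcast] at hab
      refine Subtype.ext (Vtx.ext_level_bit ha hb ?_ hab.2)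
      have h1 := ha.level_bounds
      have h2 := hb.level_bounds
      have := Int.eq_zero_of_abs_lt_dvd hab.1 (by rw [abs_lt]; omega)
      exact (sub_eq_zero.1 this).symm
    · rintro ⟨z, c⟩
      let l : ℤ := if z.val ≤ p then z.val else z.val - m
      have : NeZero m := ⟨by omega⟩
      have hz := z.val_lt
      have hl : (l : ZMod m) = z := by
        simp only [l]
        split_ifs <;> simp
      obtain ⟨w, hw, h1, h2⟩ := Vtx.exists_level_bit (p := p) (q := q) l
        (by simp only [l]; split_ifs <;> omega) (by simp only [l]; split_ifs <;> omega) c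
      exact ⟨⟨w, (hX w).2 hw⟩, by simp only [f, h1, h2, hl]⟩
  -- A cyclic step is a step of the levels or the jump from the last level `p` to the first, `-q`.
  have hstep : ∀ a b : Vtx, a.InRange p q → b.InRange p q →
      ((b.level : ZMod m) = (a.level : ZMod m) + 1 ↔
        b.level = a.level + 1 ∨ (a.level = p ∧ b.level = -q)) := by
    intro a b ha hb
    have h1 := ha.level_bounds
    have h2 := hb.level_bounds
    have e : (a.level : ZMod m) + 1 = ((a.level + 1 : ℤ) : ZMod m) := by push_cast; ring
    rw [e, hcast]
    constructor
    · rintro ⟨t, ht⟩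
      have : t < 2 := by nlinarith
      have : -1 < t := by nlinarith
      obtain rfl | rfl : t = 0 ∨ t = 1 := by omega
      · left; omega
      · right; omega
    · rintro (h | h)
      · simp [h]
      · exact ⟨1, by omega⟩
  refine ⟨⟨Equiv.ofBijective f hf, ?_⟩⟩
  rintro ⟨a, ha⟩ ⟨b, hb⟩
  rw [hX] at ha hb
  simp only [Equiv.ofBijective_apply, f, SimpleGraph.comap_adj, SimpleGraph.fromEdgeSet_adj,
    Function.Embedding.subtype_apply, hE, ha, hb, true_and]
  rw [blownUpCycle_adj (by omega), hstep a b ha hb, hstep b a hb ha, Vtx.Linked]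
  constructor
  · intro h
    refine ⟨by tauto, ?_⟩
    rintro rfl
    omega
  · tauto

theorem nonempty_famG_iso {i : ℕ} (hi : 1 ≤ i) :
    Nonempty (famG i ≃g blownUpCycle (2 * i + 3)) := by
  obtain ⟨k, rfl⟩ := Nat.exists_eq_add_of_le' hi
  have := nonempty_iso_blownUpCycle (by omega) (by omega) (famGVerts (k + 1)) (famGEdges (k + 1))
    (mem_famGVerts k) (mem_famGEdges k)
  rwa [show k + 2 + (k + 2) + 1 = 2 * (k + 1) + 3 by ring] at this

theorem nonempty_famH_iso {j : ℕ} (hj : 1 ≤ j) :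
    Nonempty (famH j ≃g blownUpCycle (2 * j + 2)) := by
  obtain ⟨k, rfl⟩ := Nat.exists_eq_add_of_le' hj
  have := nonempty_iso_blownUpCycle (by omega) (by omega) (famHVerts (k + 1)) (famHEdges (k + 1))
    (mem_famHVerts k) (mem_famHEdges k)
  rwa [show k + 2 + (k + 1) + 1 = 2 * (k + 1) + 2 by ring] at this

theorem nonempty_graphG2_iso : Nonempty (graphG2 ≃g blownUpCycle 3) := by
  -- The pairs are the three antipodal pairs `u₁u₆`, `u₂u₄`, `u₃u₅` of the octahedron.
  let f : Fin 6 → ZMod 3 × Bool := ![(0, false), (1, false), (2, false), (1, true), (2, true),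
    (0, true)]
  have hf : Function.Bijective f := by decide +kernel
  refine ⟨⟨Equiv.ofBijective f hf, ?_⟩⟩
  intro a b
  rw [Equiv.ofBijective_apply, Equiv.ofBijective_apply, blownUpCycle_adj (by norm_num)]
  simp only [graphG2, SimpleGraph.fromEdgeSet_adj, Set.mem_insert_iff, Set.mem_singleton_iff]
  revert a b
  decide +kernel

theorem inF_of_iso_blownUpCycle {V : Type*} {G : SimpleGraph V} {m : ℕ} (hm : 3 ≤ m)
    (φ : G ≃g blownUpCycle m) : InF G := by
  rcases Nat.even_or_odd' m with ⟨j, rfl | rfl⟩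
  · obtain ⟨i, rfl⟩ := Nat.exists_eq_add_of_le' (show 1 ≤ j by omega)
    obtain ⟨ψ⟩ := nonempty_famH_iso (j := i) (by omega)
    exact .inr <| .inr <| .inr <| .inr <| .inr ⟨i, by omega, ⟨φ.trans ψ.symm⟩⟩
  · obtain rfl | h := eq_or_ne j 1
    · obtain ⟨ψ⟩ := nonempty_graphG2_iso
      exact .inr <| .inl ⟨φ.trans ψ.symm⟩
    · obtain ⟨i, rfl⟩ := Nat.exists_eq_add_of_le' (show 1 ≤ j by omega)
      obtain ⟨ψ⟩ := nonempty_famG_iso (i := i) (by omega)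
      exact .inr <| .inr <| .inr <| .inr <| .inl ⟨i, by omega, ⟨φ.trans ψ.symm⟩⟩

theorem InF.hasOrthogonalSigning {V : Type*} [Fintype V] [DecidableEq V] {G : SimpleGraph V}
    (h : InF G) : HasOrthogonalSigning G := by
  rcases h with ⟨⟨φ⟩⟩ | ⟨⟨φ⟩⟩ | ⟨⟨φ⟩⟩ | ⟨⟨φ⟩⟩ | ⟨i, hi, ⟨φ⟩⟩ | ⟨j, hj, ⟨φ⟩⟩
  · exact hasOrthogonalSigning_graphG1.of_iso φ
  · obtain ⟨ψ⟩ := nonempty_graphG2_iso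
    exact (hasOrthogonalSigning_blownUpCycle le_rfl).of_iso (φ.trans ψ)
  · exact hasOrthogonalSigning_graphG3.of_iso φ
  · exact hasOrthogonalSigning_graphQ4.of_iso φ
  · obtain ⟨ψ⟩ := nonempty_famG_iso hi
    exact (hasOrthogonalSigning_blownUpCycle (by omega)).of_iso (φ.trans ψ)
  · obtain ⟨ψ⟩ := nonempty_famH_iso hj
    exact (hasOrthogonalSigning_blownUpCycle (by omega)).of_iso (φ.trans ψ)

end OptimumSkew

/-! ### Four-regular graphs with even codegrees -/

namespace OptimumSkew

/-- The neighbours of `x` are `a, b, c, d`, and these are distinct. -/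
structure HasNbrs {V : Type*} (G : SimpleGraph V) (x a b c d : V) : Prop where
  ab : a ≠ b
  ac : a ≠ c
  ad : a ≠ d
  bc : b ≠ c
  bd : b ≠ d
  cd : c ≠ d
  adj_iff : ∀ y, G.Adj x y ↔ y = a ∨ y = b ∨ y = c ∨ y = d

/-- `G` is `4`-regular, and any two distinct vertices have an even number of common neighbours:
the neighbourhood of one never meets that of the other in exactly one or three vertices. -/
structure IsEvenQuartic {V : Type*} (G : SimpleGraph V) : Prop where
  exists_nbrs : ∀ x, ∃ a b c d, HasNbrs G x a b c d
  not_one : ∀ {x y a b c d}, HasNbrs G x a b c d → y ≠ x → G.Adj y a →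
    G.Adj y b ∨ G.Adj y c ∨ G.Adj y d
  not_three : ∀ {x y a b c d}, HasNbrs G x a b c d → y ≠ x → G.Adj y a → G.Adj y b →
    G.Adj y c → G.Adj y d

section

variable {V : Type*} {G : SimpleGraph V} {x y a b c d : V}

namespace HasNbrs

theorem rotate (h : HasNbrs G x a b c d) : HasNbrs G x b c d a :=
  ⟨h.bc, h.bd, h.ab.symm, h.cd, h.ac.symm, h.ad.symm, fun y => by rw [h.adj_iff]; tauto⟩

theorem swap (h : HasNbrs G x a b c d) : HasNbrs G x b a c d :=
  ⟨h.ab.symm, h.bc, h.bd, h.ac, h.ad, h.cd, fun y => by rw [h.adj_iff]; tauto⟩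

theorem adj₁ (h : HasNbrs G x a b c d) : G.Adj x a := (h.adj_iff a).2 (by simp)

theorem adj₂ (h : HasNbrs G x a b c d) : G.Adj x b := (h.adj_iff b).2 (by simp)

theorem adj₃ (h : HasNbrs G x a b c d) : G.Adj x c := (h.adj_iff c).2 (by simp)

theorem adj₄ (h : HasNbrs G x a b c d) : G.Adj x d := (h.adj_iff d).2 (by simp)

end HasNbrs

namespace IsEvenQuartic

theorem exists_nbrs₁ (hG : IsEvenQuartic G) (ha : G.Adj x a) : ∃ b c d, HasNbrs G x a b c d := by
  obtain ⟨p, q, r, s, h⟩ := hG.exists_nbrs x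
  rcases (h.adj_iff a).1 ha with rfl | rfl | rfl | rfl
  · exact ⟨_, _, _, h⟩
  · exact ⟨_, _, _, h.rotate⟩
  · exact ⟨_, _, _, h.rotate.rotate⟩
  · exact ⟨_, _, _, h.rotate.rotate.rotate⟩

theorem exists_nbrs₂ (hG : IsEvenQuartic G) (ha : G.Adj x a) (hb : G.Adj x b) (hab : a ≠ b) :
    ∃ c d, HasNbrs G x a b c d := by
  obtain ⟨q, r, s, h⟩ := hG.exists_nbrs₁ ha
  rcases (h.adj_iff b).1 hb with rfl | rfl | rfl | rfl
  · exact absurd rfl hab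
  · exact ⟨_, _, h⟩
  · exact ⟨_, _, h.rotate.swap.rotate.rotate.rotate⟩
  · exact ⟨_, _, h.rotate.rotate.rotate.swap⟩

theorem exists_nbrs₃ (hG : IsEvenQuartic G) (ha : G.Adj x a) (hb : G.Adj x b) (hc : G.Adj x c)
    (hab : a ≠ b) (hac : a ≠ c) (hbc : b ≠ c) : ∃ d, HasNbrs G x a b c d := by
  obtain ⟨r, s, h⟩ := hG.exists_nbrs₂ ha hb hab
  rcases (h.adj_iff c).1 hc with rfl | rfl | rfl | rfl
  · exact absurd rfl hac
  · exact absurd rfl hbc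
  · exact ⟨_, h⟩
  · exact ⟨_, h.rotate.rotate.swap.rotate.rotate⟩

theorem hasNbrs (hG : IsEvenQuartic G) (ha : G.Adj x a) (hb : G.Adj x b) (hc : G.Adj x c)
    (hd : G.Adj x d) (hab : a ≠ b) (hac : a ≠ c) (had : a ≠ d) (hbc : b ≠ c) (hbd : b ≠ d)
    (hcd : c ≠ d) : HasNbrs G x a b c d := by
  obtain ⟨s, h⟩ := hG.exists_nbrs₃ ha hb hc hab hac hbc
  rcases (h.adj_iff d).1 hd with rfl | rfl | rfl | rfl
  · exact absurd rfl had
  · exact absurd rfl hbd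
  · exact absurd rfl hcd
  · exact h

theorem neighborSet_eq_of_adj (hG : IsEvenQuartic G) (h : HasNbrs G x a b c d) (ha : G.Adj y a)
    (hb : G.Adj y b) (hc : G.Adj y c) (hd : G.Adj y d) : G.neighborSet x = G.neighborSet y := by
  have h' := hG.hasNbrs ha hb hc hd h.ab h.ac h.ad h.bc h.bd h.cd
  ext z
  rw [SimpleGraph.mem_neighborSet, SimpleGraph.mem_neighborSet, h.adj_iff, h'.adj_iff]

end IsEvenQuartic

theorem forall_of_connected (hconn : G.Connected) (P : V → Prop)
    (hstep : ∀ u v, G.Adj u v → P u → P v) (hx : P x) (y : V) : P y := by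
  obtain ⟨p⟩ := hconn.preconnected x y
  induction p with
  | nil => exact hx
  | cons h _ ih => exact ih (hstep _ _ h hx)

/-- An injective homomorphism from a nonempty `4`-regular graph to a connected `4`-regular graph
is an isomorphism: its image is closed under taking neighbours. -/
theorem IsEvenQuartic.nonempty_iso (hG : IsEvenQuartic G) (hconn : G.Connected) {W : Type*}
    [Nonempty W] {H : SimpleGraph W} (nb : W → Fin 4 → W) (hnb : ∀ p, Function.Injective (nb p))
    (hadj : ∀ p i, H.Adj p (nb p i)) (f : W → V) (hf : Function.Injective f)
    (hom : ∀ p q, H.Adj p q → G.Adj (f p) (f q)) : Nonempty (G ≃g H) := by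
  have key : ∀ p v, G.Adj (f p) v → ∃ q, H.Adj p q ∧ f q = v := by
    intro p v hv
    have hne : ∀ i j : Fin 4, i ≠ j → f (nb p i) ≠ f (nb p j) := fun i j hij h =>
      hij (hnb p (hf h))
    have h := hG.hasNbrs (hom _ _ (hadj p 0)) (hom _ _ (hadj p 1)) (hom _ _ (hadj p 2))
      (hom _ _ (hadj p 3)) (hne _ _ (by decide)) (hne _ _ (by decide)) (hne _ _ (by decide))
      (hne _ _ (by decide)) (hne _ _ (by decide)) (hne _ _ (by decide))
    rcases (h.adj_iff v).1 hv with rfl | rfl | rfl | rfl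
    exacts [⟨_, hadj p 0, rfl⟩, ⟨_, hadj p 1, rfl⟩, ⟨_, hadj p 2, rfl⟩, ⟨_, hadj p 3, rfl⟩]
  have hsurj : Function.Surjective f := by
    refine forall_of_connected hconn (fun v => ∃ p, f p = v) ?_
      (x := f (Classical.arbitrary W)) ⟨_, rfl⟩
    rintro _ v huv ⟨p, rfl⟩
    obtain ⟨q, -, h⟩ := key p v huv
    exact ⟨q, h⟩
  let φ : H ≃g G := ⟨Equiv.ofBijective f ⟨hf, hsurj⟩, by
    intro p q
    refine ⟨fun h => ?_, hom p q⟩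
    obtain ⟨r, h1, h2⟩ := key p (f q) h
    rwa [← hf h2]⟩
  exact ⟨φ.symm⟩

theorem IsEvenQuartic.nonempty_iso_blownUpCycle (hG : IsEvenQuartic G) (hconn : G.Connected)
    {m : ℕ} (hm : 3 ≤ m) (f : ZMod m × Bool → V) (hf : Function.Injective f)
    (hom : ∀ (k : ZMod m) (b b' : Bool), G.Adj (f (k, b)) (f (k + 1, b'))) :
    Nonempty (G ≃g blownUpCycle m) := by
  have h2 : (2 : ZMod m) ≠ 0 := fun h => by
    have := (ZMod.natCast_eq_zero_iff 2 m).1 (by exact_mod_cast h)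
    exact absurd (Nat.le_of_dvd (by norm_num) this) (by omega)
  have hne : ∀ k : ZMod m, k + 1 ≠ k - 1 := fun k h => h2 (by linear_combination h)
  refine hG.nonempty_iso hconn
    (fun p => ![(p.1 + 1, false), (p.1 + 1, true), (p.1 - 1, false), (p.1 - 1, true)])
    (fun p i j => ?_) (fun p i => ?_) f hf (fun p q h => ?_)
  · have h1 := hne p.1
    have h2 := (hne p.1).symm
    fin_cases i <;> fin_cases j <;> simp [h1, h2]
  · rw [blownUpCycle_adj (by omega)]
    fin_cases i <;> simp
  · obtain ⟨k, b⟩ := p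
    obtain ⟨l, b'⟩ := q
    rw [blownUpCycle_adj (by omega)] at h
    rcases h with h | h
    · obtain rfl : l = k + 1 := h
      exact hom _ _ _
    · obtain rfl : k = l + 1 := h
      exact (hom _ _ _).symm

/-! ### Graphs with twins -/

/-- If `x` and `y` have the same neighbours, then every neighbour `a` of `x` has a twin: a third
neighbour `p` of `a` is adjacent to a further neighbour `b` of `x`, so that `a` and `b` share
`x`, `y` and `p`, hence everything. -/
theorem IsEvenQuartic.exists_twin_of_adj (hG : IsEvenQuartic G) (hxy : x ≠ y)
    (h : G.neighborSet x = G.neighborSet y) (ha : G.Adj x a) :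
    ∃ a', a ≠ a' ∧ G.neighborSet a = G.neighborSet a' := by
  have hN : ∀ z, G.Adj x z ↔ G.Adj y z := fun z => Set.ext_iff.1 h z
  obtain ⟨b, c, d, hx⟩ := hG.exists_nbrs₁ ha
  obtain ⟨p, q, hA⟩ := hG.exists_nbrs₂ ha.symm ((hN a).1 ha).symm hxy
  have main : ∀ b, G.Adj x b → a ≠ b → G.Adj p b →
      ∃ a', a ≠ a' ∧ G.neighborSet a = G.neighborSet a' := fun b hb hab hpb =>
    ⟨b, hab, hG.neighborSet_eq_of_adj hA hb.symm ((hN b).1 hb).symm hpb.symm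
      (hG.not_three hA hab.symm hb.symm ((hN b).1 hb).symm hpb.symm)⟩
  rcases hG.not_one hx hA.ac.symm hA.adj₃.symm with hp | hp | hp
  exacts [main b hx.adj₂ hx.ab hp, main c hx.adj₃ hx.ac hp, main d hx.adj₄ hx.ad hp]

/-- Three vertices with the same neighbours force `K_{4,4}`. -/
theorem IsEvenQuartic.inF_of_three_twins (hG : IsEvenQuartic G) (hconn : G.Connected) {z : V}
    (hxy : x ≠ y) (hxz : x ≠ z) (hyz : y ≠ z) (h1 : G.neighborSet x = G.neighborSet y)
    (h2 : G.neighborSet x = G.neighborSet z) : InF G := by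
  have hy : ∀ w, G.Adj x w ↔ G.Adj y w := fun w => Set.ext_iff.1 h1 w
  have hz : ∀ w, G.Adj x w ↔ G.Adj z w := fun w => Set.ext_iff.1 h2 w
  obtain ⟨a, b, c, d, hx⟩ := hG.exists_nbrs x
  have hxw : ∀ w, G.Adj x w → G.Adj w x ∧ G.Adj w y ∧ G.Adj w z := fun w hw =>
    ⟨hw.symm, ((hy w).1 hw).symm, ((hz w).1 hw).symm⟩
  obtain ⟨a1, a2, a3⟩ := hxw a hx.adj₁
  obtain ⟨b1, b2, b3⟩ := hxw b hx.adj₂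
  obtain ⟨c1, c2, c3⟩ := hxw c hx.adj₃
  obtain ⟨d1, d2, d3⟩ := hxw d hx.adj₄
  obtain ⟨p, hA⟩ := hG.exists_nbrs₃ a1 a2 a3 hxy hxz hyz
  have pa := hA.adj₄
  have pb := hG.not_three hA hx.ab.symm b1 b2 b3
  have pc := hG.not_three hA hx.ac.symm c1 c2 c3
  have pd := hG.not_three hA hx.ad.symm d1 d2 d3
  let t : Fin 4 → Bool → V := ![fun i => cond i y x, fun i => cond i b a, fun i => cond i p z,
    fun i => cond i d c]
  have inj : Function.Injective fun w : ZMod 4 × Bool => t w.1 w.2 := by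
    have e1 := hA.ad
    have e2 := hA.bd
    have e3 := hA.cd
    have e4 := hx.ab
    have e5 := hx.ac
    have e6 := hx.ad
    have e7 := hx.bc
    have e8 := hx.bd
    have e9 := hx.cd
    have f1 : ∀ w, G.Adj a w → w ≠ a ∧ w ≠ b ∧ w ≠ c ∧ w ≠ d := by
      intro w hw
      have hv : ∀ v, G.Adj w v → w ≠ v := fun v h => h.ne
      rcases (hA.adj_iff w).1 hw with rfl | rfl | rfl | rfl
      · exact ⟨hv _ a1.symm, hv _ b1.symm, hv _ c1.symm, hv _ d1.symm⟩
      · exact ⟨hv _ a2.symm, hv _ b2.symm, hv _ c2.symm, hv _ d2.symm⟩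
      · exact ⟨hv _ a3.symm, hv _ b3.symm, hv _ c3.symm, hv _ d3.symm⟩
      · exact ⟨hv _ pa.symm, hv _ pb.symm, hv _ pc.symm, hv _ pd.symm⟩
    have g1 := f1 _ a1
    have g2 := f1 _ a2
    have g3 := f1 _ a3
    have g4 := f1 _ pa
    rintro ⟨i, s⟩ ⟨j, r⟩ h
    change Fin 4 at i j
    fin_cases i <;> fin_cases j <;> cases s <;> cases r <;> simp [t] at h ⊢ <;> grind
  obtain ⟨φ⟩ := hG.nonempty_iso_blownUpCycle hconn (m := 4) (by norm_num) _ inj (by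
    intro k s r
    change Fin 4 at k
    fin_cases k <;> cases s <;> cases r <;>
      first | assumption | exact SimpleGraph.Adj.symm (by assumption))
  exact inF_of_iso_blownUpCycle (by norm_num) φ

end

end OptimumSkew

namespace OptimumSkew

section

variable {V : Type*} {G : SimpleGraph V}

/-- If every vertex has exactly one twin, the twin pairs form a `2`-regular graph, hence a cycle.
The cycle is found by walking from pair to pair without turning back until a pair reappears; the
first pair to reappear is the initial one. -/
theorem IsEvenQuartic.inF_of_unique_twin [Finite V] (hG : IsEvenQuartic G) (hconn : G.Connected)
    (t : V → V) (ht : ∀ x, t x ≠ x) (htN : ∀ x, G.neighborSet (t x) = G.neighborSet x)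
    (huniq : ∀ x y, G.neighborSet x = G.neighborSet y → y = x ∨ y = t x) : InF G := by
  have hadj : ∀ {x y}, G.neighborSet x = G.neighborSet y → ∀ z, G.Adj z x → G.Adj z y :=
    fun h z hz => (Set.ext_iff.1 h z |>.1 hz.symm : G.Adj _ z).symm
  have hloop : ∀ {x y}, G.Adj x y → G.neighborSet x ≠ G.neighborSet y := fun h e =>
    G.irrefl (hadj e _ h.symm)
  -- Apart from the pair of `p`, a vertex `q` adjacent to `p` sees exactly one more pair.
  have next : ∀ p q, G.Adj p q → ∃ r, G.Adj q r ∧ G.neighborSet p ≠ G.neighborSet r ∧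
      ∀ w, G.Adj q w → G.neighborSet w = G.neighborSet p ∨ G.neighborSet w = G.neighborSet r := by
    intro p q h
    obtain ⟨r, s, hq⟩ := hG.exists_nbrs₂ h.symm (hadj (htN p).symm _ h.symm) (ht p).symm
    have hpr : G.neighborSet p ≠ G.neighborSet r := fun e => by
      rcases huniq p r e with e | e
      · exact hq.ac e.symm
      · exact hq.bc e.symm
    refine ⟨r, hq.adj₃, hpr, fun w hw => ?_⟩
    rcases (hq.adj_iff w).1 hw with rfl | rfl | rfl | rfl
    · exact .inl rfl
    · exact .inl (htN p)
    · exact .inr rfl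
    · right
      -- The twin of `r` is a neighbour of `q` other than `p`, the twin of `p` and `r`.
      rcases (hq.adj_iff (t r)).1 (hadj (htN r).symm _ hq.adj₃) with e | e | e | e
      · exact absurd (e ▸ htN r) hpr
      · exact absurd ((htN p).symm.trans (e ▸ htN r)) hpr
      · exact absurd e (ht r)
      · exact e ▸ htN r
  choose! nx h1 h2 h3 using next
  obtain ⟨x0⟩ := hconn.nonempty
  obtain ⟨y0, _, _, _, hy0⟩ := hG.exists_nbrs x0
  let seq : ℕ → V × V := fun n => (fun s : V × V => (s.2, nx s.1 s.2))^[n] (x0, y0)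
  have hseq : ∀ n, G.Adj (seq n).1 (seq n).2 := by
    intro n
    induction n with
    | zero => exact hy0.adj₁
    | succ n ih =>
      simp only [seq, Function.iterate_succ_apply'] at ih ⊢
      exact h1 _ _ ih
  let x : ℕ → V := fun n => (seq n).1
  have hx1 : ∀ n, x (n + 1) = (seq n).2 := fun n => by
    simp only [x, seq, Function.iterate_succ_apply']
  have hx2 : ∀ n, x (n + 2) = nx (x n) (x (n + 1)) := fun n => by
    rw [hx1 (n + 1), hx1 n]
    simp only [x, seq, Function.iterate_succ_apply']
  have hx : ∀ n, G.Adj (x n) (x (n + 1)) := fun n => by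
    rw [hx1]
    exact hseq n
  let c : ℕ → Set V := fun n => G.neighborSet (x n)
  have hc1 : ∀ n, c n ≠ c (n + 1) := fun n => hloop (hx n)
  have hc2 : ∀ n, c n ≠ c (n + 2) := fun n => by
    simp only [c, hx2]
    exact h2 _ _ (hx n)
  have hc3 : ∀ n w, G.Adj (x (n + 1)) w → G.neighborSet w = c n ∨ G.neighborSet w = c (n + 2) := by
    intro n w hw
    simp only [c, hx2]
    exact h3 _ _ (hx n) w hw
  have hex : ∃ j, ∃ i < j, c i = c j := by
    obtain ⟨i, j, hij, h⟩ := Finite.exists_ne_map_eq_of_infinite c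
    rcases lt_or_gt_of_ne hij with h' | h'
    · exact ⟨j, i, h', h⟩
    · exact ⟨i, j, h', h.symm⟩
  classical
  obtain ⟨i, hij, hcij⟩ := Nat.find_spec hex
  have hmin : ∀ k l, k < l → l < Nat.find hex → c k ≠ c l := fun k l hkl hl e =>
    Nat.find_min hex hl ⟨k, hkl, e⟩
  generalize Nat.find hex = j at hij hcij hmin
  have hi : i = 0 := by
    by_contra hi
    obtain ⟨i, rfl⟩ := Nat.exists_eq_succ_of_ne_zero hi
    obtain ⟨j, rfl⟩ := Nat.exists_eq_succ_of_ne_zero (show j ≠ 0 by omega)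
    have hw : G.Adj (x (i + 1)) (x j) := (hadj hcij.symm _ (hx j)).symm
    rcases hc3 i _ hw with e | e
    · exact hmin i j (by omega) (by omega) e.symm
    · rcases lt_trichotomy (i + 2) j with h | h | h
      · exact hmin (i + 2) j h (by omega) e.symm
      · exact hc2 (i + 1) (by rw [hcij, ← h])
      · obtain rfl : j = i + 1 := by omega
        exact hc1 _ hcij
  subst hi
  have hj : 3 ≤ j := by
    by_contra h
    obtain rfl | rfl : j = 1 ∨ j = 2 := by omega
    · exact hc1 0 hcij
    · exact hc2 0 hcij
  have : NeZero j := ⟨by omega⟩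
  have hcb : ∀ (b : Bool) v, G.neighborSet (bif b then t v else v) = G.neighborSet v := by
    intro b v
    cases b
    · rfl
    · exact htN v
  obtain ⟨φ⟩ := hG.nonempty_iso_blownUpCycle hconn hj
    (fun p => bif p.2 then t (x p.1.val) else x p.1.val) (by
      rintro ⟨k, b⟩ ⟨l, b'⟩ h
      simp only at h
      have hkl : c k.val = c l.val :=
        (hcb b _).symm.trans ((congrArg G.neighborSet h).trans (hcb b' _))
      have hk := k.val_lt
      have hl := l.val_lt
      obtain rfl : k = l := by
        apply ZMod.val_injective
        rcases lt_trichotomy k.val l.val with h' | h' | h'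
        · exact absurd hkl (hmin _ _ h' hl)
        · exact h'
        · exact absurd hkl.symm (hmin _ _ h' hk)
      have := ht (x k.val)
      cases b <;> cases b' <;>
        first | rfl | exact absurd h this | exact absurd h.symm this) (by
      intro k b b'
      refine (hadj (hcb b _).symm _ (hadj (hcb b' _).symm _ ?_).symm).symm
      have hk := k.val_lt
      rcases Nat.lt_or_ge (k.val + 1) j with h | h
      · have : (k + 1).val = k.val + 1 := by
          have : Fact (1 < j) := ⟨by omega⟩
          rw [ZMod.val_add_of_lt] <;> rw [ZMod.val_one]
          exact h
        rw [this]
        exact hx _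
      · have e : k.val + 1 = j := by omega
        have : k + 1 = 0 := by
          have h0 := congrArg (fun n : ℕ => (n : ZMod j)) e
          simpa using h0
        rw [this, ZMod.val_zero]
        have := hx k.val
        rw [e] at this
        exact hadj hcij.symm _ this)
  exact inF_of_iso_blownUpCycle hj φ

/-- A connected graph with even codegrees and a pair of twins is a blown-up cycle. -/
theorem IsEvenQuartic.inF_of_twins [Finite V] (hG : IsEvenQuartic G) (hconn : G.Connected)
    {x y : V} (hxy : x ≠ y) (h : G.neighborSet x = G.neighborSet y) : InF G := by
  have hall : ∀ a, ∃ a', a ≠ a' ∧ G.neighborSet a = G.neighborSet a' := by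
    refine forall_of_connected hconn _ ?_ ⟨y, hxy, h⟩
    rintro u v huv ⟨u', hu, hu'⟩
    exact hG.exists_twin_of_adj hu hu' huv
  choose t ht htN using hall
  by_cases hthree : ∃ a b, G.neighborSet a = G.neighborSet b ∧ b ≠ a ∧ b ≠ t a
  · obtain ⟨a, b, h1, h2, h3⟩ := hthree
    exact hG.inF_of_three_twins hconn (ht a) h2.symm h3.symm (htN a) h1
  · push Not at hthree
    refine hG.inF_of_unique_twin hconn t (fun a => (ht a).symm) (fun a => (htN a).symm) ?_
    intro a b hab
    by_cases e : b = a
    · exact .inl e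
    · exact .inr (hthree a b hab e)

end

end OptimumSkew

/-! ### Graphs without twins -/

namespace OptimumSkew

section

variable {V : Type*} {G : SimpleGraph V}

/-- A `4`-regular graph with even codegrees and without twins. Two distinct vertices then have no or
exactly two common neighbours. -/
structure IsZeroTwo (G : SimpleGraph V) : Prop extends IsEvenQuartic G where
  not_twins : ∀ x y, x ≠ y → G.neighborSet x ≠ G.neighborSet y

namespace IsZeroTwo

variable {x y a b c d : V}

/-- The neighbourhood of `y ≠ x` meets that of `x` in no vertex or in one of the six pairs. -/
theorem inter (hG : IsZeroTwo G) (h : HasNbrs G x a b c d) (hne : y ≠ x) :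
    (¬G.Adj y a ∧ ¬G.Adj y b ∧ ¬G.Adj y c ∧ ¬G.Adj y d) ∨
    (G.Adj y a ∧ G.Adj y b ∧ ¬G.Adj y c ∧ ¬G.Adj y d) ∨
    (G.Adj y a ∧ ¬G.Adj y b ∧ G.Adj y c ∧ ¬G.Adj y d) ∨
    (G.Adj y a ∧ ¬G.Adj y b ∧ ¬G.Adj y c ∧ G.Adj y d) ∨
    (¬G.Adj y a ∧ G.Adj y b ∧ G.Adj y c ∧ ¬G.Adj y d) ∨
    (¬G.Adj y a ∧ G.Adj y b ∧ ¬G.Adj y c ∧ G.Adj y d) ∨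
    (¬G.Adj y a ∧ ¬G.Adj y b ∧ G.Adj y c ∧ G.Adj y d) := by
  have o1 := hG.not_one h hne
  have o2 := hG.not_one h.rotate hne
  have o3 := hG.not_one h.rotate.rotate hne
  have o4 := hG.not_one h.rotate.rotate.rotate hne
  have t1 := hG.not_three h hne
  have t2 := hG.not_three h.rotate hne
  have t3 := hG.not_three h.rotate.rotate hne
  have t4 := hG.not_three h.rotate.rotate.rotate hne
  have n : G.Adj y a → G.Adj y b → G.Adj y c → ¬G.Adj y d := fun ha hb hc hd =>
    hG.not_twins x y hne.symm (hG.neighborSet_eq_of_adj h ha hb hc hd)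
  grind

theorem not_three_common (hG : IsZeroTwo G) {p q r : V} (hne : x ≠ y) (hpq : p ≠ q) (hpr : p ≠ r)
    (hqr : q ≠ r) (h1 : G.Adj x p) (h2 : G.Adj x q) (h3 : G.Adj x r) (h4 : G.Adj y p)
    (h5 : G.Adj y q) : ¬G.Adj y r := by
  obtain ⟨s, h⟩ := hG.exists_nbrs₃ h1 h2 h3 hpq hpr hqr
  have := hG.inter h hne.symm
  grind

theorem exists_second_common (hG : IsZeroTwo G) {p : V} (hne : x ≠ y) (hx : G.Adj x p)
    (hy : G.Adj y p) : ∃ q, q ≠ p ∧ G.Adj x q ∧ G.Adj y q := by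
  obtain ⟨b, c, d, h⟩ := hG.exists_nbrs₁ hx
  rcases hG.not_one h hne.symm hy with h' | h' | h'
  exacts [⟨b, h.ab.symm, h.adj₂, h'⟩, ⟨c, h.ac.symm, h.adj₃, h'⟩, ⟨d, h.ad.symm, h.adj₄, h'⟩]

/-- If `x` lies in a triangle, then `x` lies in a `K₄`, and the outer neighbours of its four
vertices form a second `K₄`. -/
theorem nonempty_iso_graphG1 (hG : IsZeroTwo G) (hconn : G.Connected) (hxa : G.Adj x a)
    (hxb : G.Adj x b) (hab : G.Adj a b) : Nonempty (G ≃g graphG1) := by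
  obtain ⟨c, d, hx, hac⟩ : ∃ c d, HasNbrs G x a b c d ∧ G.Adj a c := by
    obtain ⟨c, d, hx⟩ := hG.exists_nbrs₂ hxa hxb hab.ne
    have := hG.inter hx hxa.ne.symm
    by_cases h : G.Adj a c
    · exact ⟨c, d, hx, h⟩
    · exact ⟨d, c, hx.rotate.rotate.swap.rotate.rotate, by have := G.irrefl (v := a); grind⟩
  have hxc := hx.adj₃
  have hxd := hx.adj₄
  have ia := hG.inter hx hxa.ne.symm
  have ib := hG.inter hx hxb.ne.symm
  have ic := hG.inter hx hxc.ne.symm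
  have hba := hab.symm
  have hca := hac.symm
  have irr : ∀ v, ¬G.Adj v v := fun v => G.irrefl
  have irrA := irr a
  have irrB := irr b
  have irrC := irr c
  have had : ¬G.Adj a d := by grind
  -- If `b` and `c` are not adjacent, then `a` and `d` share the three vertices `x, b, c`.
  have hbc : G.Adj b c := by
    by_contra hbc
    have hbd : G.Adj b d := by grind
    have hcb : ¬G.Adj c b := fun h => hbc h.symm
    have hcd : G.Adj c d := by grind
    exact hG.not_three_common (x := a) (y := d) hx.ad hxb.ne hxc.ne hx.bc hxa.symm hab hac
      hxd.symm hbd.symm hcd.symm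
  have hcb := hbc.symm
  have hbd : ¬G.Adj b d := by grind
  have hcd : ¬G.Adj c d := by grind
  -- `x, a, b, c` is a `K₄`, with outer neighbours `d, a', b', c'`.
  obtain ⟨a', ha⟩ := hG.exists_nbrs₃ hxa.symm hab hac hxb.ne hxc.ne hx.bc
  obtain ⟨b', hb⟩ := hG.exists_nbrs₃ hxb.symm hba hbc hxa.ne hxc.ne hx.ac
  obtain ⟨c', hc⟩ := hG.exists_nbrs₃ hxc.symm hca hcb hxa.ne hxb.ne hx.ab
  have haa := ha.adj₄
  have hbb := hb.adj₄
  have hcc := hc.adj₄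
  have hda : G.Adj d a' := by
    have := hG.inter ha hx.ad.symm
    have h1 := hxd.symm
    have h2 : ¬G.Adj d b := fun h => hbd h.symm
    have h3 : ¬G.Adj d c := fun h => hcd h.symm
    grind
  have hdb : G.Adj d b' := by
    have := hG.inter hb hx.bd.symm
    have h1 := hxd.symm
    have h2 : ¬G.Adj d a := fun h => had h.symm
    have h3 : ¬G.Adj d c := fun h => hcd h.symm
    grind
  have hdc : G.Adj d c' := by
    have := hG.inter hc hx.cd.symm
    have h1 := hxd.symm
    have h2 : ¬G.Adj d a := fun h => had h.symm
    have h3 : ¬G.Adj d b := fun h => hbd h.symm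
    grind
  have hax : ¬G.Adj x a' := fun h => by
    rcases (hx.adj_iff _).1 h with e | e | e | e
    · exact irrA (e ▸ haa)
    · exact ha.bd e.symm
    · exact ha.cd e.symm
    · exact had (e ▸ haa)
  have hbx : ¬G.Adj x b' := fun h => by
    rcases (hx.adj_iff _).1 h with e | e | e | e
    · exact hb.bd e.symm
    · exact irrB (e ▸ hbb)
    · exact hb.cd e.symm
    · exact hbd (e ▸ hbb)
  have hab' : ¬G.Adj b a' := fun h => hG.not_three_common hx.ab hxc.ne ha.ad ha.cd
    hxa.symm hac haa hxb.symm hbc h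
  have hac' : ¬G.Adj c a' := fun h => hG.not_three_common hx.ac hxb.ne ha.ad ha.bd
    hxa.symm hab haa hxc.symm hcb h
  have hbc' : ¬G.Adj c b' := fun h => hG.not_three_common hx.bc hxa.ne hb.ad hb.bd
    hxb.symm hba hbb hxc.symm hca h
  have hba' : ¬G.Adj a b' := fun h => hG.not_three_common hx.ab.symm hxc.ne hb.ad hb.cd
    hxb.symm hbc hbb hxa.symm hac h
  have hA'B' : G.Adj a' b' := by
    have := hG.inter hb (y := a') ha.bd.symm
    have h1 := haa.symm
    have h2 : ¬G.Adj a' x := fun h => hax h.symm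
    have h3 : ¬G.Adj a' c := fun h => hac' h.symm
    grind
  have hA'C' : G.Adj a' c' := by
    have := hG.inter hc (y := a') ha.cd.symm
    have h1 := haa.symm
    have h2 : ¬G.Adj a' x := fun h => hax h.symm
    have h3 : ¬G.Adj a' b := fun h => hab' h.symm
    grind
  have hB'C' : G.Adj b' c' := by
    have := hG.inter hc (y := b') hb.cd.symm
    have h1 := hbb.symm
    have h2 : ¬G.Adj b' x := fun h => hbx h.symm
    have h3 : ¬G.Adj b' a := fun h => hba' h.symm
    grind
  let l : List V := [x, a, b, c, d, a', b', c']
  have hl : l.Nodup := by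
    simp only [l, List.nodup_cons, List.mem_cons, List.not_mem_nil, or_false, not_or,
      not_false_eq_true, List.nodup_nil, and_true]
    refine ⟨⟨hxa.ne, hxb.ne, hxc.ne, hxd.ne, ha.ad, hb.ad, hc.ad⟩,
      ⟨hx.ab, hx.ac, hx.ad, haa.ne, hb.bd, hc.bd⟩, ⟨hx.bc, hx.bd, ha.bd, hbb.ne, hc.cd⟩,
      ⟨hx.cd, ha.cd, hb.cd, hcc.ne⟩, ⟨hda.ne, hdb.ne, hdc.ne⟩, ⟨hA'B'.ne, hA'C'.ne⟩, hB'C'.ne⟩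
  refine hG.nonempty_iso hconn (W := Fin 8)
    ![![1, 2, 3, 4], ![0, 2, 3, 5], ![0, 1, 3, 6], ![0, 1, 2, 7],
      ![0, 5, 6, 7], ![1, 4, 6, 7], ![2, 4, 5, 7], ![3, 4, 5, 6]]
    (by decide +kernel) ?_ l.get (List.nodup_iff_injective_get.1 hl) ?_
  · simp only [graphG1, SimpleGraph.fromEdgeSet_adj, Set.mem_insert_iff, Set.mem_singleton_iff]
    decide +kernel
  · have hsub : {s(0, 1), s(0, 2), s(0, 3), s(1, 2), s(1, 3), s(2, 3),
        s(4, 5), s(4, 6), s(4, 7), s(5, 6), s(5, 7), s(6, 7),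
        s(0, 4), s(1, 5), s(2, 6), s(3, 7)} ⊆ {e : Sym2 (Fin 8) | e.map l.get ∈ G.edgeSet} := by
      simp only [Set.insert_subset_iff, Set.singleton_subset_iff]
      exact ⟨hxa, hxb, hxc, hab, hac, hbc, hda, hdb, hdc, hA'B', hA'C', hB'C', hxd, haa, hbb, hcc⟩
    intro p q h
    exact hsub ((SimpleGraph.fromEdgeSet_adj _).1 h).1

end IsZeroTwo

end

end OptimumSkew

namespace OptimumSkew

section

variable {V : Type*} {G : SimpleGraph V}

/-! ### Triangle-free graphs without twins -/

namespace IsZeroTwo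

/-- The first three layers around a vertex `x` with neighbours `a, b, c, d`: for each pair of
neighbours a second common neighbour, `ab` being that of `a` and `b`. -/
structure Layers (G : SimpleGraph V) (x a b c d ab ac ad bc bd cd : V) : Prop where
  nx : HasNbrs G x a b c d
  na : HasNbrs G a x ab ac ad
  nb : HasNbrs G b x ab bc bd
  nc : HasNbrs G c x ac bc cd
  nd : HasNbrs G d x ad bd cd
  iab : ¬G.Adj ab c ∧ ¬G.Adj ab d
  iac : ¬G.Adj ac b ∧ ¬G.Adj ac d
  iad : ¬G.Adj ad b ∧ ¬G.Adj ad c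
  ibc : ¬G.Adj bc a ∧ ¬G.Adj bc d
  ibd : ¬G.Adj bd a ∧ ¬G.Adj bd c
  icd : ¬G.Adj cd a ∧ ¬G.Adj cd b

theorem exists_layers (hG : IsZeroTwo G) (x : V) :
    ∃ a b c d ab ac ad bc bd cd, Layers G x a b c d ab ac ad bc bd cd := by
  obtain ⟨a, b, c, d, h⟩ := hG.exists_nbrs x
  have ha := h.adj₁.symm
  have hb := h.adj₂.symm
  have hc := h.adj₃.symm
  have hd := h.adj₄.symm
  obtain ⟨ab, ab0, ab1, ab2⟩ := hG.exists_second_common h.ab ha hb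
  obtain ⟨ac, ac0, ac1, ac2⟩ := hG.exists_second_common h.ac ha hc
  obtain ⟨ad, ad0, ad1, ad2⟩ := hG.exists_second_common h.ad ha hd
  obtain ⟨bc, bc0, bc1, bc2⟩ := hG.exists_second_common h.bc hb hc
  obtain ⟨bd, bd0, bd1, bd2⟩ := hG.exists_second_common h.bd hb hd
  obtain ⟨cd, cd0, cd1, cd2⟩ := hG.exists_second_common h.cd hc hd
  have iab := hG.inter h ab0
  have iac := hG.inter h ac0
  have iad := hG.inter h ad0
  have ibc := hG.inter h bc0
  have ibd := hG.inter h bd0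
  have icd := hG.inter h cd0
  simp only [G.adj_comm _ a, G.adj_comm _ b, G.adj_comm _ c, G.adj_comm _ d]
    at iab iac iad ibc ibd icd
  have hne : ∀ {u v w : V}, G.Adj w u → ¬G.Adj w v → u ≠ v := by
    rintro u v w h1 h2 rfl
    exact h2 h1
  have jab : ¬G.Adj c ab ∧ ¬G.Adj d ab := by grind
  have jac : ¬G.Adj b ac ∧ ¬G.Adj d ac := by grind
  have jad : ¬G.Adj b ad ∧ ¬G.Adj c ad := by grind
  have jbc : ¬G.Adj a bc ∧ ¬G.Adj d bc := by grind
  have jbd : ¬G.Adj a bd ∧ ¬G.Adj c bd := by grind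
  have jcd : ¬G.Adj a cd ∧ ¬G.Adj b cd := by grind
  have cm : ∀ {u v w : V}, ¬G.Adj v u ∧ ¬G.Adj w u → ¬G.Adj u v ∧ ¬G.Adj u w := fun h =>
    ⟨fun e => h.1 e.symm, fun e => h.2 e.symm⟩
  exact ⟨a, b, c, d, ab, ac, ad, bc, bd, cd, h,
    hG.hasNbrs ha ab1 ac1 ad1 ab0.symm ac0.symm ad0.symm (hne ab2 jac.1) (hne ab2 jad.1)
      (hne ac2 jad.2),
    hG.hasNbrs hb ab2 bc1 bd1 ab0.symm bc0.symm bd0.symm (hne ab1 jbc.1) (hne ab1 jbd.1)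
      (hne bc2 jbd.2),
    hG.hasNbrs hc ac2 bc2 cd1 ac0.symm bc0.symm cd0.symm (hne ac1 jbc.1) (hne ac1 jcd.1)
      (hne bc1 jcd.2),
    hG.hasNbrs hd ad2 bd2 cd2 ad0.symm bd0.symm cd0.symm (hne ad1 jbd.1) (hne ad1 jcd.1)
      (hne bd1 jcd.2),
    cm jab, cm jac, cm jad, cm jbc, cm jbd, cm jcd⟩

variable {x a b c d ab ac ad bc bd cd : V}

/-- A vertex `e ≠ a` adjacent to two of the second-layer neighbours of `a` is adjacent either to
the three second-layer vertices of a triangle of `K₄` or to the four of a `4`-cycle. -/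
theorem Layers.type_of_adj (hG : IsZeroTwo G) (L : Layers G x a b c d ab ac ad bc bd cd) {e : V}
    (ha : e ≠ a) (h1 : G.Adj e ab) (h2 : G.Adj e ac) :
    ¬G.Adj e x ∧ ¬G.Adj e ad ∧ ((G.Adj e bc ∧ ¬G.Adj e bd ∧ ¬G.Adj e cd) ∨
      (¬G.Adj e bc ∧ G.Adj e bd ∧ G.Adj e cd)) := by
  have hb : e ≠ b := by
    rintro rfl
    exact L.iac.1 h2.symm
  have hc : e ≠ c := by
    rintro rfl
    exact L.iab.1 h1.symm
  have hd : e ≠ d := by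
    rintro rfl
    exact L.iab.2 h1.symm
  have ia := hG.inter L.na ha
  have ib := hG.inter L.nb hb
  have ic := hG.inter L.nc hc
  have i4 := hG.inter L.nd hd
  grind

theorem Layers.swap_bc (L : Layers G x a b c d ab ac ad bc bd cd) :
    Layers G x a c b d ac ab ad bc cd bd :=
  ⟨L.nx.rotate.swap.rotate.rotate.rotate, L.na.rotate.swap.rotate.rotate.rotate,
    L.nc, L.nb, L.nd.rotate.rotate.swap.rotate.rotate, L.iac, L.iab, L.iad.symm, L.ibc,
    L.icd, L.ibd⟩

theorem Layers.swap_cd (L : Layers G x a b c d ab ac ad bc bd cd) :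
    Layers G x a b d c ab ad ac bd bc cd :=
  ⟨L.nx.rotate.rotate.swap.rotate.rotate, L.na.rotate.rotate.swap.rotate.rotate,
    L.nb.rotate.rotate.swap.rotate.rotate, L.nd, L.nc, L.iab.symm, L.iad, L.iac, L.ibd, L.ibc, L.icd⟩

theorem Layers.swap_ab (L : Layers G x a b c d ab ac ad bc bd cd) :
    Layers G x b a c d ab bc bd ac ad cd :=
  ⟨L.nx.swap, L.nb, L.na, L.nc.rotate.swap.rotate.rotate.rotate,
    L.nd.rotate.swap.rotate.rotate.rotate, L.iab, L.ibc, L.ibd, L.iac, L.iad, L.icd.symm⟩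

/-- The second-layer vertices `ab` and `ac` have a common neighbour `e` besides `a`; it lies in a
third layer. -/
theorem Layers.exists_third (hG : IsZeroTwo G) (L : Layers G x a b c d ab ac ad bc bd cd) :
    ∃ e, G.Adj e ab ∧ G.Adj e ac ∧ ¬G.Adj e x ∧ ¬G.Adj e ad ∧
      ((G.Adj e bc ∧ ¬G.Adj e bd ∧ ¬G.Adj e cd) ∨ (¬G.Adj e bc ∧ G.Adj e bd ∧ G.Adj e cd)) := by
  obtain ⟨e, e0, e1, e2⟩ := hG.exists_second_common L.na.bc L.na.adj₂.symm L.na.adj₃.symm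
  exact ⟨e, e1.symm, e2.symm, L.type_of_adj hG e0 e1.symm e2.symm⟩

theorem Layers.nodup (L : Layers G x a b c d ab ac ad bc bd cd)
    (tf : ∀ u v w, G.Adj u v → G.Adj v w → ¬G.Adj u w) :
    [x, a, b, c, d, ab, ac, ad, bc, bd, cd].Nodup := by
  have hne : ∀ {u v w : V}, G.Adj w u → ¬G.Adj w v → u ≠ v := by
    rintro u v w h1 h2 rfl
    exact h2 h1
  have s : ∀ {u v : V}, ¬G.Adj u v → ¬G.Adj v u := fun h e => h e.symm
  have xab := tf _ _ _ L.nx.adj₁ L.na.adj₂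
  have xac := tf _ _ _ L.nx.adj₁ L.na.adj₃
  have xad := tf _ _ _ L.nx.adj₁ L.na.adj₄
  have xbc := tf _ _ _ L.nx.adj₂ L.nb.adj₃
  have xbd := tf _ _ _ L.nx.adj₂ L.nb.adj₄
  have xcd := tf _ _ _ L.nx.adj₃ L.nc.adj₄
  simp only [List.nodup_cons, List.mem_cons, List.not_mem_nil, or_false, not_or,
    not_false_eq_true, List.nodup_nil, and_true]
  exact
   ⟨⟨L.nx.adj₁.ne, L.nx.adj₂.ne, L.nx.adj₃.ne, L.nx.adj₄.ne, L.na.ab, L.na.ac, L.na.ad, L.nb.ac,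
      L.nb.ad, L.nc.ad⟩,
    ⟨L.nx.ab, L.nx.ac, L.nx.ad, L.na.adj₂.ne, L.na.adj₃.ne, L.na.adj₄.ne, hne L.nx.adj₁ xbc,
      hne L.nx.adj₁ xbd, hne L.nx.adj₁ xcd⟩,
    ⟨L.nx.bc, L.nx.bd, L.nb.adj₂.ne, hne L.nx.adj₂ xac, hne L.nx.adj₂ xad, L.nb.adj₃.ne,
      L.nb.adj₄.ne, hne L.nx.adj₂ xcd⟩,
    ⟨L.nx.cd, hne L.nx.adj₃ xab, L.nc.adj₂.ne, hne L.nx.adj₃ xad, L.nc.adj₃.ne,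
      hne L.nx.adj₃ xbd, L.nc.adj₄.ne⟩,
    ⟨hne L.nx.adj₄ xab, hne L.nx.adj₄ xac, L.nd.adj₂.ne, hne L.nx.adj₄ xbc, L.nd.adj₃.ne,
      L.nd.adj₄.ne⟩,
    ⟨L.na.bc, L.na.bd, L.nb.bc, L.nb.bd, hne L.na.adj₂ (s L.icd.1)⟩,
    ⟨L.na.cd, L.nc.bc, hne L.na.adj₃ (s L.ibd.1), L.nc.bd⟩,
    ⟨hne L.na.adj₄ (s L.ibc.1), L.nd.bc, L.nd.bd⟩, ⟨L.nb.cd, L.nc.cd⟩, L.nd.cd⟩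

/-- A third-layer vertex is not in the first three layers: it is not adjacent to `x`, and two
vertices with a common neighbour are not adjacent. -/
theorem Layers.not_mem (L : Layers G x a b c d ab ac ad bc bd cd)
    (tf : ∀ u v w, G.Adj u v → G.Adj v w → ¬G.Adj u w) {e : V} (e1 : G.Adj e ab)
    (e2 : G.Adj e ac) (ex : ¬G.Adj e x) : e ∉ [x, a, b, c, d, ab, ac, ad, bc, bd, cd] := by
  simp only [List.mem_cons, List.not_mem_nil, or_false]
  rintro (rfl | rfl | rfl | rfl | rfl | rfl | rfl | rfl | rfl | rfl | rfl)
  · exact tf _ _ _ L.nx.adj₁ L.na.adj₂ e1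
  · exact ex L.na.adj₁
  · exact ex L.nb.adj₁
  · exact ex L.nc.adj₁
  · exact ex L.nd.adj₁
  · exact G.irrefl e1
  · exact G.irrefl e2
  · exact tf _ _ _ L.na.adj₄.symm L.na.adj₂ e1
  · exact tf _ _ _ L.nb.adj₃.symm L.nb.adj₂ e1
  · exact tf _ _ _ L.nb.adj₄.symm L.nb.adj₂ e1
  · exact tf _ _ _ L.nc.adj₄.symm L.nc.adj₂ e2

/-- If the third-layer vertex `e` sees the `4`-cycle `ab, bd, cd, ac`, then the two remaining
`4`-cycles are seen as well, and there is no fourth layer. -/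
theorem Layers.nonempty_iso_graphG3 (hG : IsZeroTwo G) (hconn : G.Connected)
    (L : Layers G x a b c d ab ac ad bc bd cd)
    (tf : ∀ u v w, G.Adj u v → G.Adj v w → ¬G.Adj u w) {e : V} (e1 : G.Adj e ab)
    (e2 : G.Adj e ac) (ex : ¬G.Adj e x) (e3 : ¬G.Adj e ad) (e4 : ¬G.Adj e bc) (e5 : G.Adj e bd)
    (e6 : G.Adj e cd) : Nonempty (G ≃g graphG3) := by
  obtain ⟨f, f1, f3, fx, f2, hf⟩ := L.swap_cd.exists_third hG
  obtain ⟨g, g3, g2, gx, g1, hg⟩ := L.swap_cd.swap_bc.swap_cd.exists_third hG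
  have hne : ∀ {u v w : V}, G.Adj u w → ¬G.Adj v w → u ≠ v := by
    rintro u v w h1 h2 rfl
    exact h2 h1
  have hef := hne e2 f2
  have heg := hne e1 g1
  have hfg := hne f1 g1
  have hbe := hne L.nb.adj₁ ex
  have hbf := hne L.nb.adj₁ fx
  have hce := hne L.nc.adj₁ ex
  have hcg := hne L.nc.adj₁ gx
  -- Otherwise `ab` and `bd` would share the three vertices `b, e, f`.
  have f5 : ¬G.Adj f bd := fun h => hG.not_three_common L.nb.bd hbe hbf hef
    L.nb.adj₂.symm e1.symm f1.symm L.nb.adj₄.symm e5.symm h.symm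
  have f4 : G.Adj f bc := by tauto
  have f6 : G.Adj f cd := by tauto
  have g6 : ¬G.Adj g cd := fun h => hG.not_three_common L.nc.bd hce hcg heg
    L.nc.adj₂.symm e2.symm g2.symm L.nc.adj₄.symm e6.symm h.symm
  have g4 : G.Adj g bc := by tauto
  have g5 : G.Adj g bd := by tauto
  let l : List V := [x, a, b, c, d, ab, ac, ad, bc, bd, cd] ++ [e, f, g]
  have hl : l.Nodup := by
    refine List.Nodup.append (L.nodup tf) (by simp [hef, heg, hfg]) ?_
    have me := L.not_mem tf e1 e2 ex
    have mf := L.swap_cd.not_mem tf f1 f3 fx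
    have mg := L.swap_cd.swap_bc.swap_cd.not_mem tf g3 g2 gx
    simp only [List.disjoint_right, List.mem_cons, List.not_mem_nil, or_false, not_or]
      at me mf mg ⊢
    rintro v (rfl | rfl | rfl)
    · exact me
    · grind only
    · grind only
  refine hG.nonempty_iso hconn (W := Fin 14)
    ![![1, 2, 3, 4], ![0, 5, 6, 7], ![0, 5, 8, 9], ![0, 6, 8, 10], ![0, 7, 9, 10],
      ![1, 2, 11, 12], ![1, 3, 11, 13], ![1, 4, 12, 13], ![2, 3, 12, 13], ![2, 4, 11, 13],
      ![3, 4, 11, 12], ![5, 6, 9, 10], ![5, 7, 8, 10], ![6, 7, 8, 9]]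
    (by decide +kernel) ?_ l.get (List.nodup_iff_injective_get.1 hl) ?_
  · simp only [graphG3, SimpleGraph.fromEdgeSet_adj, Set.mem_insert_iff, Set.mem_singleton_iff]
    decide +kernel
  · have hsub : {s(0, 1), s(0, 2), s(0, 3), s(0, 4),
        s(1, 5), s(1, 6), s(1, 7), s(2, 5), s(2, 8), s(2, 9),
        s(3, 6), s(3, 8), s(3, 10), s(4, 7), s(4, 9), s(4, 10),
        s(5, 11), s(5, 12), s(6, 11), s(6, 13), s(7, 12), s(7, 13),
        s(8, 12), s(8, 13), s(9, 11), s(9, 13), s(10, 11), s(10, 12)} ⊆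
        {e : Sym2 (Fin 14) | e.map l.get ∈ G.edgeSet} := by
      simp only [Set.insert_subset_iff, Set.singleton_subset_iff]
      exact ⟨L.nx.adj₁, L.nx.adj₂, L.nx.adj₃, L.nx.adj₄, L.na.adj₂, L.na.adj₃, L.na.adj₄,
        L.nb.adj₂, L.nb.adj₃, L.nb.adj₄, L.nc.adj₂, L.nc.adj₃, L.nc.adj₄, L.nd.adj₂, L.nd.adj₃,
        L.nd.adj₄, e1.symm, f1.symm, e2.symm, g2.symm, f3.symm, g3.symm, f4.symm, g4.symm,
        e5.symm, g5.symm, e6.symm, f6.symm⟩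
    intro p q h
    exact hsub ((SimpleGraph.fromEdgeSet_adj _).1 h).1

/-- If the third-layer vertex `e` sees the triangle `ab, ac, bc`, then the three remaining
triangles are seen as well, and the third-layer vertices have a common neighbour. -/
theorem Layers.nonempty_iso_graphQ4 (hG : IsZeroTwo G) (hconn : G.Connected)
    (L : Layers G x a b c d ab ac ad bc bd cd)
    (tf : ∀ u v w, G.Adj u v → G.Adj v w → ¬G.Adj u w) {e : V} (e1 : G.Adj e ab)
    (e2 : G.Adj e ac) (ex : ¬G.Adj e x) (e3 : ¬G.Adj e ad) (e4 : G.Adj e bc) (e5 : ¬G.Adj e bd)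
    (e6 : ¬G.Adj e cd) : Nonempty (G ≃g graphQ4) := by
  obtain ⟨f, f1, f3, fx, f2, hf⟩ := L.swap_cd.exists_third hG
  obtain ⟨g, g3, g2, gx, g1, hg⟩ := L.swap_cd.swap_bc.swap_cd.exists_third hG
  obtain ⟨h, h5, h4, hx, h1, hh⟩ := L.swap_ab.swap_cd.swap_bc.swap_cd.exists_third hG
  have hne : ∀ {u v w : V}, G.Adj u w → ¬G.Adj v w → u ≠ v := by
    rintro u v w h1 h2 rfl
    exact h2 h1
  have hef := hne e2 f2
  have heg := hne e1 g1
  have hfg := hne f1 g1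
  have heh := hne e1 h1
  have hfh := hne f1 h1
  have hbe := hne L.nb.adj₁ ex
  have hbf := hne L.nb.adj₁ fx
  have hce := hne L.nc.adj₁ ex
  have hcg := hne L.nc.adj₁ gx
  have hch := hne L.nc.adj₁ hx
  -- Otherwise `ab` and `bc` would share the three vertices `b, e, f`.
  have f4 : ¬G.Adj f bc := fun h => hG.not_three_common L.nb.bc hbe hbf hef
    L.nb.adj₂.symm e1.symm f1.symm L.nb.adj₃.symm e4.symm h.symm
  have f5 : G.Adj f bd := by tauto
  have f6 : ¬G.Adj f cd := by tauto
  have g4 : ¬G.Adj g bc := fun h => hG.not_three_common L.nc.bc hce hcg heg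
    L.nc.adj₂.symm e2.symm g2.symm L.nc.adj₃.symm e4.symm h.symm
  have g6 : G.Adj g cd := by tauto
  have g5 : ¬G.Adj g bd := by tauto
  have h2 : ¬G.Adj h ac := fun h' => hG.not_three_common L.nc.bc hce hch heh
    L.nc.adj₂.symm e2.symm h'.symm L.nc.adj₃.symm e4.symm h4.symm
  have h6 : G.Adj h cd := by tauto
  have h3 : ¬G.Adj h ad := by tauto
  have hgh := hne g2 h2
  obtain ⟨z, ne⟩ := hG.exists_nbrs₃ e1 e2 e4 L.na.bc L.nb.bc L.nc.bc
  have ez := ne.adj₄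
  have fz : G.Adj f z := by
    have := hG.inter ne hef.symm
    grind
  have gz : G.Adj g z := by
    have := hG.inter ne heg.symm
    grind
  have hz : G.Adj h z := by
    have := hG.inter ne heh.symm
    grind
  let l : List V := [x, a, b, c, d, ab, ac, ad, bc, bd, cd] ++ [e, f, g, h, z]
  have hl : l.Nodup := by
    refine List.Nodup.append (L.nodup tf)
      (by simp [hef, heg, hfg, heh, hfh, hgh, ez.ne, fz.ne, gz.ne, hz.ne]) ?_
    have me := L.not_mem tf e1 e2 ex
    have mf := L.swap_cd.not_mem tf f1 f3 fx
    have mg := L.swap_cd.swap_bc.swap_cd.not_mem tf g3 g2 gx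
    have mh := L.swap_ab.swap_cd.swap_bc.swap_cd.not_mem tf h5 h4 hx
    simp only [List.disjoint_right, List.mem_cons, List.not_mem_nil, or_false, not_or]
      at me mf mg mh ⊢
    rintro v (rfl | rfl | rfl | rfl | rfl)
    · exact me
    · grind only
    · grind only
    · grind only
    · exact ⟨(hne ez.symm fun h' => ex h'.symm),
        (hne ez.symm fun h' => tf _ _ _ h' e1 L.na.adj₂),
        (hne ez.symm fun h' => tf _ _ _ h' e1 L.nb.adj₂),
        (hne ez.symm fun h' => tf _ _ _ h' e2 L.nc.adj₂),
        (hne fz.symm fun h' => tf _ _ _ h' f3 L.nd.adj₂),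
        (hne gz.symm fun h' => g1 h'.symm), (hne fz.symm fun h' => f2 h'.symm),
        (hne ez.symm fun h' => e3 h'.symm), (hne fz.symm fun h' => f4 h'.symm),
        (hne ez.symm fun h' => e5 h'.symm), (hne ez.symm fun h' => e6 h'.symm)⟩
  -- A word is sent to the vertex reached from `x` by its support in `a, b, c, d`.
  let code : (Fin 4 → Bool) → Fin 16 := fun w =>
    ![0, 1, 2, 5, 3, 6, 8, 11, 4, 7, 9, 12, 10, 13, 14, 15]
      (Fin.ofNat 16 ((w 0).toNat + 2 * (w 1).toNat + 4 * (w 2).toNat + 8 * (w 3).toNat))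
  let E : List (Fin 16 × Fin 16) := [(0, 1), (0, 2), (0, 3), (0, 4),
    (1, 5), (1, 6), (1, 7), (2, 5), (2, 8), (2, 9), (3, 6), (3, 8), (3, 10), (4, 7), (4, 9),
    (4, 10), (11, 5), (11, 6), (11, 8), (12, 5), (12, 7), (12, 9), (13, 6), (13, 7), (13, 10),
    (14, 8), (14, 9), (14, 10), (11, 15), (12, 15), (13, 15), (14, 15)]
  have hcode : ∀ p q, hammingDist p q = 1 → (code p, code q) ∈ E ∨ (code q, code p) ∈ E := by
    decide +kernel
  have hE : ∀ s ∈ E, G.Adj (l.get s.1) (l.get s.2) := by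
    simp only [E, List.forall_mem_cons, List.not_mem_nil, false_imp_iff, implies_true, and_true]
    exact ⟨L.nx.adj₁, L.nx.adj₂, L.nx.adj₃, L.nx.adj₄, L.na.adj₂, L.na.adj₃, L.na.adj₄,
      L.nb.adj₂, L.nb.adj₃, L.nb.adj₄, L.nc.adj₂, L.nc.adj₃, L.nc.adj₄, L.nd.adj₂, L.nd.adj₃,
      L.nd.adj₄, e1, e2, e4, f1, f3, f5, g2, g3, g6, h4, h5, h6, ez, fz, gz, hz⟩
  refine hG.nonempty_iso hconn (W := Fin 4 → Bool) (fun w i => Function.update w i (!w i))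
    (by decide +kernel) (fun p i => ?_) (fun w => l.get (code w)) ?_ fun p q hpq => ?_
  · revert p i
    simp only [graphQ4]
    decide +kernel
  · have : Function.Injective code := by decide +kernel
    exact (List.nodup_iff_injective_get.1 hl).comp this
  · rcases hcode p q hpq with h' | h'
    · exact hE _ h'
    · exact (hE _ h').symm

end IsZeroTwo

/-! ### The classification -/

/-- The connected `4`-regular graphs with even codegrees are those of the class. -/
theorem IsEvenQuartic.inF [Finite V] (hG : IsEvenQuartic G) (hconn : G.Connected) : InF G := by
  by_cases htw : ∃ x y, x ≠ y ∧ G.neighborSet x = G.neighborSet y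
  · obtain ⟨x, y, hxy, h⟩ := htw
    exact hG.inF_of_twins hconn hxy h
  push Not at htw
  have hZ : IsZeroTwo G := ⟨hG, htw⟩
  by_cases htri : ∃ u v w, G.Adj u v ∧ G.Adj v w ∧ G.Adj u w
  · obtain ⟨u, v, w, h1, h2, h3⟩ := htri
    exact .inl (hZ.nonempty_iso_graphG1 hconn h1 h3 h2)
  push Not at htri
  obtain ⟨x⟩ := hconn.nonempty
  obtain ⟨a, b, c, d, ab, ac, ad, bc, bd, cd, L⟩ := hZ.exists_layers x
  obtain ⟨e, e1, e2, ex, e3, ⟨e4, e5, e6⟩ | ⟨e4, e5, e6⟩⟩ := L.exists_third hZ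
  · exact .inr <| .inr <| .inr <| .inl
      (L.nonempty_iso_graphQ4 hZ hconn htri e1 e2 ex e3 e4 e5 e6)
  · exact .inr <| .inr <| .inl (L.nonempty_iso_graphG3 hZ hconn htri e1 e2 ex e3 e4 e5 e6)

/-- If `S(σ)ᵀ S(σ) = 4 I`, the rows of two vertices are orthogonal, and a sum of one or three
signs is not zero. -/
theorem isEvenQuartic_of_orientation [Fintype V] [DecidableEq V] [DecidableRel G.Adj]
    (hreg : G.IsRegularOfDegree 4) (σ : GraphOrientation G)
    (hσ : (σ.skewAdjMatrix ℝ)ᵀ * σ.skewAdjMatrix ℝ = (4 : ℝ) • (1 : Matrix V V ℝ)) :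
    IsEvenQuartic G := by
  have hzero : ∀ x y, ¬G.Adj x y → σ.skewAdjMatrix ℝ x y = 0 := fun x y h => by
    have := σ.skewAdjMatrix_sq ℝ x y
    rw [if_neg h] at this
    exact mul_self_eq_zero.1 this
  have hone : ∀ x y, G.Adj x y → σ.skewAdjMatrix ℝ x y = 1 ∨ σ.skewAdjMatrix ℝ x y = -1 :=
    fun x y h => by
      have := σ.skewAdjMatrix_sq ℝ x y
      rw [if_pos h] at this
      exact mul_self_eq_one_iff.1 this
  have hsum : ∀ {x y a b c d}, HasNbrs G x a b c d → y ≠ x →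
      σ.skewAdjMatrix ℝ x a * σ.skewAdjMatrix ℝ y a +
      σ.skewAdjMatrix ℝ x b * σ.skewAdjMatrix ℝ y b +
      σ.skewAdjMatrix ℝ x c * σ.skewAdjMatrix ℝ y c +
      σ.skewAdjMatrix ℝ x d * σ.skewAdjMatrix ℝ y d = 0 := by
    intro x y a b c d h hne
    have h0 := congrFun (congrFun hσ x) y
    rw [Matrix.mul_apply, Matrix.smul_apply, Matrix.one_apply_ne hne.symm, smul_zero] at h0
    have h1 : ∀ z, (σ.skewAdjMatrix ℝ)ᵀ x z * σ.skewAdjMatrix ℝ z y =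
        σ.skewAdjMatrix ℝ x z * σ.skewAdjMatrix ℝ y z := fun z => by
      rw [Matrix.transpose_apply, σ.skewAdjMatrix_swap ℝ z x, σ.skewAdjMatrix_swap ℝ z y,
        neg_mul_neg]
    simp only [h1] at h0
    rw [← Finset.sum_subset (Finset.subset_univ {a, b, c, d}) fun z _ hz => by
      rw [hzero x z fun hxz => hz (by simpa using (h.adj_iff z).1 hxz), zero_mul]] at h0
    rw [Finset.sum_insert (by simp [h.ab, h.ac, h.ad]), Finset.sum_insert (by simp [h.bc, h.bd]),
      Finset.sum_pair h.cd] at h0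
    linarith
  refine ⟨fun x => ?_, fun {x y a b c d} h hne ha => ?_, fun {x y a b c d} h hne ha hb hc => ?_⟩
  · have h4 : (G.neighborFinset x).card = 4 := hreg.degree_eq x
    obtain ⟨a, b, c, d, hab, hac, had, hbc, hbd, hcd, hN⟩ := Finset.card_eq_four.1 h4
    refine ⟨a, b, c, d, hab, hac, had, hbc, hbd, hcd, fun y => ?_⟩
    rw [← SimpleGraph.mem_neighborFinset, hN]
    simp
  · have := hsum h hne
    by_contra! hn
    rw [hzero _ _ hn.1, hzero _ _ hn.2.1, hzero _ _ hn.2.2] at this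
    rcases hone _ _ h.adj₁ with e1 | e1 <;> rcases hone _ _ ha with e2 | e2 <;>
      rw [e1, e2] at this <;> norm_num at this
  · have := hsum h hne
    by_contra hn
    rw [hzero _ _ hn] at this
    have key : ∀ {u : V}, G.Adj x u → G.Adj y u →
        σ.skewAdjMatrix ℝ x u * σ.skewAdjMatrix ℝ y u = 1 ∨
        σ.skewAdjMatrix ℝ x u * σ.skewAdjMatrix ℝ y u = -1 := by
      intro u h1 h2
      rcases hone _ _ h1 with e1 | e1 <;> rcases hone _ _ h2 with e2 | e2 <;> simp [e1, e2]
    rcases key h.adj₁ ha with e1 | e1 <;> rcases key h.adj₂ hb with e2 | e2 <;>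
      rcases key h.adj₃ hc with e3 | e3 <;> rw [e1, e2, e3] at this <;>
      norm_num at this

end

end OptimumSkew

theorem mainTheorem1 {V : Type*} [Fintype V] [DecidableEq V] (G : SimpleGraph V)
    [DecidableRel G.Adj] (hconn : G.Connected) (hreg : G.IsRegularOfDegree 4) :
    (∀ σ : OptimumSkew.GraphOrientation G,
      σ.IsOptimum ↔ (σ.skewAdjMatrix ℝ)ᵀ * σ.skewAdjMatrix ℝ = (4 : ℝ) • (1 : Matrix V V ℝ)) ∧
    ((∃ σ : OptimumSkew.GraphOrientation G, σ.IsOptimum) ↔ OptimumSkew.InF G) := by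
  have := hconn.nonempty
  refine ⟨fun σ => σ.isOptimum_iff hreg, ?_, fun h => ?_⟩
  · rintro ⟨σ, hσ⟩
    exact (OptimumSkew.isEvenQuartic_of_orientation hreg σ
      ((σ.isOptimum_iff hreg).1 hσ)).inF hconn
  · obtain ⟨σ, hσ⟩ := h.hasOrthogonalSigning.exists_orientation
    exact ⟨σ, (σ.isOptimum_iff hreg).2 hσ⟩
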